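/- **Conventions.** Let $Set$ be the category of (small) sets and $Top_{open}$ the category of (small) topological spaces whose morphisms are the open maps (maps sending open sets to open sets). In $hCAT$ a morphism between categories is a functor, and two functors are equal if they are naturally isomorphic; "equal in $hCAT$" below means "naturally isomorphic". For a functor $P\colon A\to Cat$ and a functor $x\colon U\to A$ let $[\![x]\!]$ be the oplax colimit (Grothendieck construction) of $u\mapsto P(x(u))$, i.e. the strict pullback along $x$ of the Grothendieck opfibration $p\colon F\to A$ classified by $P$; objects are pairs $(u,i)$ with $i\in P(x(u))$. A functor $g\colon U\to V$ with an isomorphism $\alpha\colon x\cong y\circ g$ induces $g\times_\alpha F\colon[\![x]\!]\to[\![y]\!]$; for $g=\mathrm{id}$ write $[\![\alpha]\!]$. *A dependent adder (up to isomorphism)* is a category $A$ with such a $P$, a unit object $1_F$ of $F$ (put $1_A=p(1_F)$), for all $x\colon U\to A$, $f\colon[\![x]\!]\to A$ a functor $\sum_x f\colon U\to A$, and a functor $f^\flat\colon[\![f]\!]\to[\![\sum_x f]\!]$ over $U$, such that: (Naturality) given $g\colon U\to V$, $\alpha\colon x\cong y\circ g$ and $\theta\colon f\cong f'\circ(g\times_\alpha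 F)$, there is an isomorphism $\sigma\colon\sum_x f\cong(\sum_y f')\circ g$ with $(g\times_\sigma F)\circ f^\flat\cong f'^\flat\circ((g\times_\alpha F)\times_\theta F)$ over $V$; (Units) there is $\rho\colon\sum_x 1_A\cong x$ such that $\sum_{1_A}(f\circ[\![\rho]\!]\circ 1_A^\flat)\cong f$ for all $f\colon [\![x]\!]\to A$; (Associativity) for $g\colon[\![\sum_xf]\!]\to A$ there is $\sigma\colon\sum_{\sum_x f}g\cong\sum_x\sum_f (g\circ f^\flat)$ such that $(\sum_f g\circ f^\flat)^\flat\circ(g\circ f^\flat)^\flat\cong[\![\sigma]\!]\circ g^\flat\circ(f^\flat\times_A F)$ over $U$. *A left $A$-dependent module (up to isomorphism)* is a category $M$ with $P_M\colon M\to Cat$ (giving $[\![m]\!]_M$ for $m\colon U\to M$), functors $\sum_m f\colon U\to M$ for $f\colon[\![m]\!]_M\to A$, and functors $f^{M,\flat}\colon[\![f]\!]\to[\![\sum_m f]\!]_M$ over $U$, such that: the analogous Naturality holds; (Unit) $\sum_m 1_A\cong m$; and, with $f\boxtimes g:=\sum_f (g\circ f^{M,\flat})$, (Associativity) for $g\colon[\![\sum_m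 f]\!]_M\to A$ there is $\sigma\colon\sum_{\sum_m f}g\cong\sum_m (f\boxtimes g)$ such that $(f\boxtimes g)^{M,\flat}\circ(g\circ f^{M,\flat})^\flat\cong[\![\sigma]\!]_M\circ g^{M,\flat}\circ(f^{M,\flat}\times_A F)$ over $U$. For a presheaf of sets $\mathscr F$ on $X$ the étalé space $Et(\mathscr F)=\coprod_{x\in X}\mathscr F_x$ has the topology generated by the sets $\epsilon_{\mathscr F}(U,s)=\{(x,s_x)\mid x\in U\}$, $s\in\mathscr F(U)$. For an open map $k\colon X\to Y$ and a presheaf $\mathscr F$ on $Y$ put $(k^*\mathscr F)(U)=\mathscr F(k(U))$. For $\mathscr G$ a presheaf on $Et(\mathscr F)$ put $(\mathscr F\boxtimes\mathscr G)(V)=\coprod_{s\in\mathscr F(V)}\mathscr G(\epsilon_{\mathscr F}(V,s))$. **Theorem.** 1. $Set$, with $P(S)$ the discrete category on $S$, unit the one-point set, sums $(\sum_x f)(u)=\coprod_{t\in x(u)}f(u,t)$ and flattening $((u,t),a)\mapsto(u,(t,a))$, is a dependent adder in the above sense. 2. $Top_{open}$, with $P_M(X)$ the poset of open subsets of $X$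 with reverse inclusions (an open map acting by taking images), $(\sum_m f)(d)=Et(\mathscr F_d)$ where $\mathscr F_d=f(d,-)$ is a presheaf on $m(d)$, and flattening $((d,U),s)\mapsto(d,\epsilon_{\mathscr F_d}(U,s))$, is a left $Set$-dependent module in the above sense. If $m$ takes all morphisms to continuous maps, then so does $\sum_m f$. Moreover $(f\boxtimes g)(d,-)\cong\mathscr F_d\boxtimes\mathscr G_d$, with $\mathscr G_d=g(d,-)$, by the identity on pairs $(s,t)$. 3. $Et$ is a functor from presheaves on $X$ to $Top_{open}$, and $Et(\tau)(\epsilon_{\mathscr F}(U,s))=\epsilon_{\mathscr G}(U,\tau_U(s))$ for $\tau\colon\mathscr F\to\mathscr G$. For every open map $k\colon X\to Y$ and presheaf $\mathscr F$ on $Y$ the maps on stalks give an open map $Et_k\colon Et(k^*\mathscr F)\to Et(\mathscr F)$, $(x,s_x)\mapsto(k(x),s_{k(x)})$ for $s\in\mathscr F(k(U))$; it satisfies $Et_k(\epsilon_{k^*\mathscr F}(U,s))=\epsilon_{\mathscr F}(k(U),s)$ and is natural in $\mathscr F$ and compatible with identities and composition in $k$. 4. For all $X$, presheaves $\mathscr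 F$ on $X$ and $\mathscr G$ on $Et(\mathscr F)$ there are bijections $(\mathscr F\boxtimes\mathscr G)_x\cong\coprod_{s\in\mathscr F_x}\mathscr G_{(x,s)}$, $(s,t)_x\mapsto(s_x,t_{(x,s_x)})$, for $x\in X$, and the induced map $\Phi\colon Et(\mathscr G)\to Et(\mathscr F\boxtimes\mathscr G)$ is a homeomorphism with $\epsilon_{\mathscr F\boxtimes\mathscr G}(U,(s,t))=\Phi(\epsilon_{\mathscr G}(\epsilon_{\mathscr F}(U,s),t))$ for all open $U\subseteq X$, $s\in\mathscr F(U)$, $t\in\mathscr G(\epsilon_{\mathscr F}(U,s))$. It is natural in $(X,\mathscr F,\mathscr G)$ with respect to open maps $k\colon X\to X'$ and morphisms $\mathscr F\to k^*\mathscr F'$, $\mathscr G\to Et(k,\tau)^*\mathscr G'$, where $Et(k,\tau)\colon Et(\mathscr F)\to Et(\mathscr F')$ is the open map induced by $k$ and $\tau\colon\mathscr F\to k^*\mathscr F'$. -/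

import Mathlib

open CategoryTheory TopologicalSpace Opposite

universe v w u

/-- Topological spaces, as objects of the category whose morphisms are the open maps. -/
structure TopOpen : Type (u + 1) where
  space : TopCat.{u}

namespace TopOpen

/-- A map sending open sets to open sets. -/
@[ext]
structure Hom (X Y : TopOpen.{u}) : Type u where
  toFun : X.space → Y.space
  isOpenMap : IsOpenMap toFun

instance : Category.{u} TopOpen.{u} where
  Hom X Y := Hom X Y
  id X := ⟨id, IsOpenMap.id⟩
  comp f g := ⟨g.toFun ∘ f.toFun, g.isOpenMap.comp f.isOpenMap⟩

theorem hom_ext {X Y : TopOpen.{u}} {f g : X ⟶ Y} (h : ∀ x, f.toFun x = g.toFun x) : f = g :=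
  Hom.ext (funext h)

@[simp] theorem id_toFun (X : TopOpen.{u}) (x : X.space) : Hom.toFun (𝟙 X) x = x := rfl

@[simp] theorem comp_toFun {X Y Z : TopOpen.{u}} (f : X ⟶ Y) (g : Y ⟶ Z) (x : X.space) :
    (f ≫ g).toFun x = g.toFun (f.toFun x) := rfl

/-- The image of an open set under an open map. -/
def image {X Y : TopOpen.{u}} (f : X ⟶ Y) (U : Opens X.space) : Opens Y.space :=
  ⟨f.toFun '' U, f.isOpenMap _ U.isOpen⟩

/-- The image functor on open sets ordered by inclusion. -/
def imageFunctor {X Y : TopOpen.{u}} (f : X ⟶ Y) : Opens X.space ⥤ Opens Y.space where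
  obj := image f
  map i := homOfLE (Set.image_mono i.le)

/-- The functor sending `X` to the poset of open subsets of `X` with reverse inclusions, and an
open map to the image functor. -/
def ouv : TopOpen.{u} ⥤ Cat.{u, u} where
  obj X := Cat.of (Opens X.space)ᵒᵖ
  map f := (imageFunctor f).op.toCatHom
  map_id X := by
    apply Cat.Hom.ext
    refine CategoryTheory.Functor.ext (fun U => ?_) (fun _ _ _ => Quiver.Hom.unop_inj (Subsingleton.elim _ _))
    exact congrArg op (Opens.ext (Set.image_id _))
  map_comp f g := by
    apply Cat.Hom.ext
    refine CategoryTheory.Functor.ext (fun U => ?_) (fun _ _ _ => Quiver.Hom.unop_inj (Subsingleton.elim _ _))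
    exact congrArg op (Opens.ext (Set.image_comp g.toFun f.toFun _))

/-- Presheaves of sets on `X`. -/
abbrev Psh (X : TopOpen.{u}) := TopCat.Presheaf (Type u) X.space

/-- The presheaf `U ↦ F (f(U))`. -/
def pull {X Y : TopOpen.{u}} (f : X ⟶ Y) (F : Psh Y) : Psh X :=
  (ouv.map f).toFunctor ⋙ F

/-- The étalé space of a presheaf. Its points are the pairs of a point `x` and an element of the
stalk at `x`; its topology is generated by the sets of germs of sections. -/
def et {X : TopOpen.{u}} (F : Psh X) : TopOpen.{u} := ⟨TopCat.of F.EtaleSpace⟩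


/-- The set of germs of a section `s` over `U`. -/
def epsSet {X : TopOpen.{u}} (F : Psh X) (U : Opens X.space) (s : F.obj (op U)) :
    Set F.EtaleSpace :=
  {g | ∃ h : g.base ∈ U, g.germ = F.germ U g.base h s}

/-- The set `{(x, s_x) | x ∈ U}` of germs of a section `s` over `U`, as an open set. -/
def eps {X : TopOpen.{u}} (F : Psh X) (U : Opens X.space) (s : F.obj (op U)) : Opens (et F).space :=
  ⟨epsSet F U s, isOpen_generateFrom_of_mem ⟨U, s, rfl⟩⟩

theorem eps_res {X : TopOpen.{u}} (F : Psh X) {U V : (Opens X.space)ᵒᵖ} (i : U ⟶ V)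
    (s : F.obj U) : eps F V.unop (F.map i s) ≤ eps F U.unop s := by
  rintro g ⟨h, hg⟩
  exact ⟨i.unop.le h, hg.trans (TopCat.Presheaf.germ_res_apply' F i g.base h s)⟩

theorem mem_epsSet {X : TopOpen.{u}} (F : Psh X) (U : Opens X.space) (s : F.obj (op U))
    (e : F.EtaleSpace) : e ∈ epsSet F U s ↔ ∃ (x : X.space) (h : x ∈ U), ⟨x, F.germ U x h s⟩ = e := by
  constructor
  · rcases e with ⟨x, g⟩
    rintro ⟨h, hg⟩
    exact ⟨x, h, congrArg (TopCat.Presheaf.EtaleSpace.mk x) hg.symm⟩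
  · rintro ⟨x, h, rfl⟩
    exact ⟨h, rfl⟩

/-- The topology of an étalé space has the sets `epsSet F U s` as a basis; hence a map out of it is
open as soon as it sends each of these sets to an open set. -/
theorem isOpenMap_of_epsSet {X : TopOpen.{u}} (F : Psh X) {Z : Type u} [TopologicalSpace Z]
    (k : F.EtaleSpace → Z) (h : ∀ U s, IsOpen (k '' epsSet F U s)) : IsOpenMap k := by
  have hb : IsTopologicalBasis
      {W : Set F.EtaleSpace | ∃ (U : Opens X.space) (s : F.obj (op U)), W = epsSet F U s} := by
    refine ⟨?_, ?_, ?_⟩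
    · rintro _ ⟨U, s, rfl⟩ _ ⟨V, t, rfl⟩ e ⟨⟨h1, h2⟩, ⟨h3, h4⟩⟩
      obtain ⟨W, hW, iU, iV, hst⟩ := F.germ_eq e.base h1 h3 s t (h2.symm.trans h4)
      refine ⟨_, ⟨W, F.map iU.op s, rfl⟩, ⟨hW, ?_⟩, fun e' he' => ⟨?_, ?_⟩⟩
      · rw [h2]; exact (TopCat.Presheaf.germ_res_apply F iU e.base hW s).symm
      · exact eps_res F iU.op s he'
      · rw [hst] at he'; exact eps_res F iV.op t he'
    · refine Set.eq_univ_of_forall fun e => ?_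
      obtain ⟨U, m, s, hs⟩ := F.exists_germ_eq e.germ
      exact ⟨_, ⟨U, s, rfl⟩, m, hs.symm⟩
    · refine congrArg TopologicalSpace.generateFrom (Set.ext fun W => ?_)
      constructor
      · rintro ⟨U, s, rfl⟩; exact ⟨U, s, rfl⟩
      · rintro ⟨U, s, rfl⟩; exact ⟨U, s, rfl⟩
  refine hb.isOpenMap_iff.2 ?_
  rintro _ ⟨U, s, rfl⟩
  exact h U s

/-- The map of étalé spaces assembled from the maps on stalks of a morphism of presheaves. -/
noncomputable def etPshFun {X : TopOpen.{u}} {F G : Psh X} (τ : F ⟶ G) (e : F.EtaleSpace) :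
    G.EtaleSpace :=
  ⟨e.base, (TopCat.Presheaf.stalkFunctor (Type u) e.base).map τ e.germ⟩

theorem etPshFun_germ {X : TopOpen.{u}} {F G : Psh X} (τ : F ⟶ G) (U : Opens X.space)
    (x : X.space) (h : x ∈ U) (s : F.obj (op U)) :
    etPshFun τ ⟨x, F.germ U x h s⟩ = ⟨x, G.germ U x h (τ.app (op U) s)⟩ :=
  congrArg (TopCat.Presheaf.EtaleSpace.mk x)
    (TopCat.Presheaf.stalkFunctor_map_germ_apply U x h τ s)

theorem etPshFun_image {X : TopOpen.{u}} {F G : Psh X} (τ : F ⟶ G) (U : Opens X.space)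
    (s : F.obj (op U)) :
    etPshFun τ '' epsSet F U s = epsSet G U (τ.app (op U) s) := by
  ext e
  simp only [Set.mem_image, mem_epsSet]
  constructor
  · rintro ⟨_, ⟨x, h, rfl⟩, rfl⟩
    exact ⟨x, h, (etPshFun_germ τ U x h s).symm⟩
  · rintro ⟨x, h, rfl⟩
    exact ⟨_, ⟨x, h, rfl⟩, etPshFun_germ τ U x h s⟩

/-- The open map `Et(F) → Et(G)` of étalé spaces induced by a morphism of presheaves. -/
noncomputable def etPsh {X : TopOpen.{u}} {F G : Psh X} (τ : F ⟶ G) : et F ⟶ et G :=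
  ⟨etPshFun τ, isOpenMap_of_epsSet F (etPshFun τ) fun U s => by
    rw [etPshFun_image]; exact (eps G U _).isOpen⟩

/-- The map on stalks `colim_{x ∈ U} F(f(U)) → colim_{f(x) ∈ V} F(V)`. -/
noncomputable def stalkPull {X Y : TopOpen.{u}} (f : X ⟶ Y) (F : Psh Y) (x : X.space) :
    (pull f F).stalk x ⟶ F.stalk (f.toFun x) :=
  Limits.colimit.desc ((OpenNhds.inclusion x).op ⋙ pull f F)
    { pt := F.stalk (f.toFun x)
      ι :=
        { app := fun U => F.germ (image f U.unop.1) (f.toFun x) ⟨x, U.unop.2, rfl⟩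
          naturality := fun U V i => by
            ext s
            exact TopCat.Presheaf.germ_res_apply' F ((imageFunctor f).op.map
              ((OpenNhds.inclusion x).op.map i)) (f.toFun x) ⟨x, V.unop.2, rfl⟩ s } }

theorem stalkPull_germ {X Y : TopOpen.{u}} (f : X ⟶ Y) (F : Psh Y) (x : X.space)
    (U : Opens X.space) (h : x ∈ U) (s : (pull f F).obj (op U)) :
    stalkPull f F x ((pull f F).germ U x h s) = F.germ (image f U) (f.toFun x) ⟨x, h, rfl⟩ s :=
  ConcreteCategory.congr_hom (Limits.colimit.ι_desc (F := (OpenNhds.inclusion x).op ⋙ pull f F)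
    _ (op ⟨U, h⟩)) s

/-- The map `Et(f^* F) → Et(F)` assembled from the maps on stalks. -/
noncomputable def etPullFun {X Y : TopOpen.{u}} (f : X ⟶ Y) (F : Psh Y)
    (e : (pull f F).EtaleSpace) : F.EtaleSpace :=
  ⟨f.toFun e.base, stalkPull f F e.base e.germ⟩

theorem etPullFun_germ {X Y : TopOpen.{u}} (f : X ⟶ Y) (F : Psh Y) (U : Opens X.space)
    (x : X.space) (h : x ∈ U) (s : (pull f F).obj (op U)) :
    etPullFun f F ⟨x, (pull f F).germ U x h s⟩ =
      ⟨f.toFun x, F.germ (image f U) (f.toFun x) ⟨x, h, rfl⟩ s⟩ :=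
  congrArg (TopCat.Presheaf.EtaleSpace.mk (f.toFun x)) (stalkPull_germ f F x U h s)

theorem etPullFun_image {X Y : TopOpen.{u}} (f : X ⟶ Y) (F : Psh Y) (U : Opens X.space)
    (s : (pull f F).obj (op U)) :
    etPullFun f F '' epsSet (pull f F) U s = epsSet F (image f U) s := by
  ext e
  constructor
  · rintro ⟨_, hm, rfl⟩
    obtain ⟨x, h, rfl⟩ := (mem_epsSet _ _ _ _).1 hm
    exact (mem_epsSet F _ s _).2 ⟨f.toFun x, ⟨x, h, rfl⟩, (etPullFun_germ f F U x h s).symm⟩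
  · intro hm
    obtain ⟨_, ⟨x, h, rfl⟩, rfl⟩ := (mem_epsSet F _ s _).1 hm
    exact ⟨_, (mem_epsSet _ _ _ _).2 ⟨x, h, rfl⟩, etPullFun_germ f F U x h s⟩

/-- The open map `Et(f^* F) → Et(F)`. -/
noncomputable def etPull {X Y : TopOpen.{u}} (f : X ⟶ Y) (F : Psh Y) : et (pull f F) ⟶ et F :=
  ⟨etPullFun f F, isOpenMap_of_epsSet (pull f F) (etPullFun f F) fun U s => by
    rw [etPullFun_image]; exact (eps F _ s).isOpen⟩

/-- The open map `Et(F) → Et(f^* G) → Et(G)` induced by an open map `f : X → Y` and a morphism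
of presheaves `F → f^* G`. -/
noncomputable def etMap {X Y : TopOpen.{u}} (f : X ⟶ Y) {F : Psh X} {G : Psh Y}
    (τ : F ⟶ pull f G) : et F ⟶ et G :=
  etPsh τ ≫ etPull f G

theorem etMap_germ {X Y : TopOpen.{u}} (f : X ⟶ Y) {F : Psh X} {G : Psh Y}
    (τ : F ⟶ pull f G) (U : Opens X.space) (x : X.space) (h : x ∈ U) (s : F.obj (op U)) :
    (etMap f τ).toFun (TopCat.Presheaf.EtaleSpace.mk x (F.germ U x h s)) =
      TopCat.Presheaf.EtaleSpace.mk (f.toFun x)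
        (G.germ (image f U) (f.toFun x) ⟨x, h, rfl⟩ (τ.app (op U) s)) :=
  (congrArg (etPullFun f G) (etPshFun_germ τ U x h s)).trans (etPullFun_germ f G U x h _)

theorem etMap_image {X Y : TopOpen.{u}} (f : X ⟶ Y) {F : Psh X} {G : Psh Y}
    (τ : F ⟶ pull f G) (U : Opens X.space) (s : F.obj (op U)) :
    image (etMap f τ) (eps F U s) = eps G (image f U) (τ.app (op U) s) :=
  Opens.ext (((Set.image_comp (etPullFun f G) (etPshFun τ) _).trans
    (congrArg _ (etPshFun_image τ U s))).trans (etPullFun_image f G U _))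

/-- A map out of an étalé space is determined by its values on germs of sections. -/
theorem et_hom_ext {X Z : TopOpen.{u}} {F : Psh X} {k l : et F ⟶ Z}
    (h : ∀ (U : Opens X.space) (x : X.space) (hx : x ∈ U) (s : F.obj (op U)),
      k.toFun (TopCat.Presheaf.EtaleSpace.mk x (F.germ U x hx s)) =
        l.toFun (TopCat.Presheaf.EtaleSpace.mk x (F.germ U x hx s))) : k = l := by
  refine hom_ext ?_
  rintro ⟨x, g⟩
  obtain ⟨U, hx, s, rfl⟩ := F.exists_germ_eq g
  exact h U x hx s

end TopOpen

/-! ### Dependent adders and left modules in categories and functors up to isomorphism -/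

/-- For a functor `x : U ⥤ A` and a family of categories `fam : A ⥤ Cat`, the category `⟦x⟧`, i.e.
the (explicit) oplax colimit of the categories `fam (x u)`. It is the pullback along `x` of the
Grothendieck opfibration `p : F → A` classified by `fam`, where `F = Grothendieck fam`. -/
abbrev Tot {A : Type*} [Category* A] (fam : A ⥤ Cat.{u, u}) {U : Type*} [Category* U]
    (x : U ⥤ A) :=
  Grothendieck (x ⋙ fam)

namespace Tot

variable {A : Type*} [Category* A] (fam : A ⥤ Cat.{u, u})

/-- The projection `p_x : ⟦x⟧ ⥤ U`. -/
abbrev proj {U : Type*} [Category* U] (x : U ⥤ A) : Tot fam x ⥤ U :=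
  Grothendieck.forget (x ⋙ fam)

/-- The functor `⟦g ⋙ y⟧ ⥤ ⟦y⟧`, i.e. `g ×_A id_F`. -/
abbrev pre {U V : Type*} [Category* U] [Category* V] (g : U ⥤ V) (y : V ⥤ A) :
    Tot fam (g ⋙ y) ⥤ Tot fam y :=
  Grothendieck.pre (y ⋙ fam) g

/-- The functor `⟦x⟧ ⥤ ⟦y⟧` induced by a natural transformation `x ⟶ y`. -/
abbrev map {U : Type*} [Category* U] {x y : U ⥤ A} (α : x ⟶ y) : Tot fam x ⥤ Tot fam y :=
  Grothendieck.map (Functor.whiskerRight α fam)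

/-- The functor `g ×_A id_F : ⟦x⟧ ⥤ ⟦y⟧` of a triangle `x ⟶ g ⋙ y` over `A`. -/
abbrev change {U V : Type*} [Category* U] [Category* V] {x : U ⥤ A} (g : U ⥤ V) {y : V ⥤ A}
    (α : x ⟶ g ⋙ y) : Tot fam x ⥤ Tot fam y :=
  map fam α ⋙ pre fam g y

end Tot

namespace Tot

variable {A : Type*} [Category* A] (fam : A ⥤ Cat.{u, u})

theorem hom_heq {U : Type*} [Category* U] (m : U ⥤ A) {p q p' q' : Tot fam m} (hp : p = p')
    (hq : q = q') (k : p ⟶ q) (l : p' ⟶ q') (hb : k.base ≍ l.base)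
    (h : (pre fam m (𝟭 A)).map k ≍ (pre fam m (𝟭 A)).map l) : k ≍ l := by
  subst hp hq
  refine heq_of_eq (Grothendieck.ext k l (eq_of_heq hb) ?_)
  have h' : k.fiber = eqToHom _ ≫ l.fiber := Grothendieck.congr (eq_of_heq h)
  rw [h', eqToHom_trans_assoc, eqToHom_refl, Category.id_comp]

/-- The square formed by `⟦m⟧ ⥤ F`, `⟦m⟧ ⥤ U`, `p : F ⥤ A` and `m : U ⥤ A` is a (strict) pullback
square of categories, where `F = Grothendieck fam`. -/
theorem existsUnique_lift {U T : Type*} [Category* U] [Category* T] (m : U ⥤ A)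
    (a : T ⥤ U) (b : T ⥤ Grothendieck fam) (h : a ⋙ m = b ⋙ Grothendieck.forget fam) :
    ∃! c : T ⥤ Tot fam m, c ⋙ proj fam m = a ∧ c ⋙ pre fam m (𝟭 A) = b := by
  let b' : T ⥤ Grothendieck ((b ⋙ Grothendieck.forget fam) ⋙ fam) :=
    { obj t := ⟨t, (b.obj t).fiber⟩
      map k := ⟨k, (b.map k).fiber⟩
      map_id t := Grothendieck.ext _ _ rfl (by
        have := Grothendieck.congr (b.map_id t)
        simp [this]
        erw [eqToHom_trans, eqToHom_trans])
      map_comp k l := Grothendieck.ext _ _ rfl (by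
        have := Grothendieck.congr (b.map_comp k l)
        simp [this]
        erw [eqToHom_trans_assoc, eqToHom_trans_assoc]
        rfl) }
  have key : ∀ (n : T ⥤ A) (b' : T ⥤ Grothendieck (n ⋙ fam)), a ⋙ m = n →
      b' ⋙ Grothendieck.forget _ = 𝟭 T →
      ∃ c : T ⥤ Tot fam m, c ⋙ proj fam m = a ∧
        c ⋙ pre fam m (𝟭 A) = b' ⋙ Grothendieck.pre fam n := by
    rintro _ b' rfl hb'
    refine ⟨b' ⋙ Grothendieck.pre (m ⋙ fam) a, ?_, rfl⟩
    change (b' ⋙ Grothendieck.forget _) ⋙ a = a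
    rw [hb']
    rfl
  obtain ⟨c, hc, hc'⟩ := key _ b' h rfl
  refine ⟨c, ⟨hc, hc'⟩, ?_⟩
  rintro c₁ ⟨h₁, h₂⟩
  have e₁ : c₁ ⋙ proj fam m = c ⋙ proj fam m := h₁.trans hc.symm
  have e₂ : c₁ ⋙ pre fam m (𝟭 A) = c ⋙ pre fam m (𝟭 A) := h₂.trans hc'.symm
  have ho : ∀ t, c₁.obj t = c.obj t := fun t => by
    have o₁ : (c₁.obj t).base = (c.obj t).base := Functor.congr_obj e₁ t
    have o₂ : (pre fam m (𝟭 A)).obj (c₁.obj t) = (pre fam m (𝟭 A)).obj (c.obj t) :=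
      Functor.congr_obj e₂ t
    revert o₁ o₂
    generalize c₁.obj t = x
    generalize c.obj t = y
    cases x; cases y
    intro o₁ o₂
    cases o₁
    injection o₂ with _ o₃
    cases o₃
    rfl
  refine CategoryTheory.Functor.hext ho fun s t k => hom_heq fam m (ho s) (ho t) _ _ ?_ ?_
  · exact CategoryTheory.Functor.hcongr_hom e₁ k
  · exact CategoryTheory.Functor.hcongr_hom e₂ k

end Tot

/-- Two functors `F G : C ⥤ D` over `E` (via `p : D ⥤ E`) are isomorphic over `E`. -/
def IsoOver {C D E : Type*} [Category* C] [Category* D] [Category* E] (p : D ⥤ E)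
    (F G : C ⥤ D) : Prop :=
  ∃ (e : F ≅ G) (h : F ⋙ p = G ⋙ p), Functor.whiskerRight e.hom p = eqToHom h

/-- The data of a dependent adder on a category `A`. -/
structure AdderData (A : Type (u + 1)) [Category.{u} A] where
  /-- The opfibration `p : F → A`, given by its fibres. -/
  fam : A ⥤ Cat.{u, u}
  /-- The unit `1_F`. -/
  unit : Grothendieck fam
  /-- The dependent sum `∑_x f`. -/
  sum {U : Type (max w (u + 1))} [Category.{max v u} U] (x : U ⥤ A) (f : Tot fam x ⥤ A) : U ⥤ A
  /-- The flattening `f^♭`. -/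
  flat {U : Type (max w (u + 1))} [Category.{max v u} U] (x : U ⥤ A) (f : Tot fam x ⥤ A) :
    Tot fam f ⥤ Tot fam (sum x f)

namespace AdderData

variable {A : Type (u + 1)} [Category.{u} A] (S : AdderData.{v, w, u} A)

/-- The constant functor with value `1_A = p(1_F)`. -/
abbrev constOne (C : Type*) [Category* C] : C ⥤ A := (Functor.const C).obj S.unit.base

/-- The laws of a dependent adder in `hCAT`, the category of categories and isomorphism classes of
functors: equalities of morphisms of `hCAT` are natural isomorphisms of functors. -/
structure IsDependentAdder : Prop where
  /-- `f^♭` is a functor over `U`. -/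
  flat_over {U : Type (max w (u + 1))} [Category.{max v u} U] (x : U ⥤ A) (f : Tot S.fam x ⥤ A) :
    S.flat x f ⋙ Tot.proj S.fam (S.sum x f) = Tot.proj S.fam f ⋙ Tot.proj S.fam x
  /-- The sum is natural in triangles over the base that commute up to an isomorphism `α`, and
  depends on the family only up to isomorphism `θ`; the flattening is compatible with this. -/
  natural {U V : Type (max w (u + 1))} [Category.{max v u} U] [Category.{max v u} V]
    (g : U ⥤ V) (x : U ⥤ A) (y : V ⥤ A) (α : x ≅ g ⋙ y)
    (f : Tot S.fam x ⥤ A) (f' : Tot S.fam y ⥤ A) (θ : f ≅ Tot.change S.fam g α.hom ⋙ f') :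
    ∃ σ : S.sum x f ≅ g ⋙ S.sum y f',
      IsoOver (Tot.proj S.fam (S.sum y f'))
        (S.flat x f ⋙ Tot.change S.fam g σ.hom)
        (Tot.change S.fam (Tot.change S.fam g α.hom) θ.hom ⋙ S.flat y f')
  /-- Right unit axiom `∑_x 1 = x` and left unit axiom `∑_1 (f ∘ 1^♭) = f`. -/
  unit {U : Type (max w (u + 1))} [Category.{max v u} U] (x : U ⥤ A) :
    ∃ ρ : S.sum x (S.constOne _) ≅ x, ∀ f : Tot S.fam x ⥤ A,
      Nonempty (S.sum (S.constOne _) (S.flat x (S.constOne _) ⋙ Tot.map S.fam ρ.hom ⋙ f) ≅ f)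
  /-- Sum associativity (the isomorphism `σ`), and flatten associativity, i.e. commutativity of the
  square of flattening functors, where `⟦∑_{∑ f} g⟧` is identified with `⟦∑ ∑_f g ∘ f^♭⟧`
  along `σ`. -/
  assoc {U : Type (max w (u + 1))} [Category.{max v u} U] (x : U ⥤ A) (f : Tot S.fam x ⥤ A)
    (g : Tot S.fam (S.sum x f) ⥤ A) :
    ∃ σ : S.sum (S.sum x f) g ≅ S.sum x (S.sum f (S.flat x f ⋙ g)),
      IsoOver (Tot.proj S.fam (S.sum x (S.sum f (S.flat x f ⋙ g))))
        (S.flat f (S.flat x f ⋙ g) ⋙ S.flat x (S.sum f (S.flat x f ⋙ g)))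
        (Tot.pre S.fam (S.flat x f) g ⋙ S.flat (S.sum x f) g ⋙ Tot.map S.fam σ.hom)

end AdderData

/-- The data of a left module `M` over a dependent adder `A`. -/
structure ModuleData {A : Type (u + 1)} [Category.{u} A] (S : AdderData.{v, w, u} A)
    (M : Type (u + 1)) [Category.{u} M] where
  /-- The opfibration `p : F_M → M`, given by its fibres. -/
  fam : M ⥤ Cat.{u, u}
  /-- The dependent sum `∑_m f`. -/
  sum {U : Type (max w (u + 1))} [Category.{max v u} U] (m : U ⥤ M) (f : Tot fam m ⥤ A) : U ⥤ M
  /-- The flattening `f^{M,♭}`. -/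
  flat {U : Type (max w (u + 1))} [Category.{max v u} U] (m : U ⥤ M) (f : Tot fam m ⥤ A) :
    Tot S.fam f ⥤ Tot fam (sum m f)

namespace ModuleData

variable {A : Type (u + 1)} [Category.{u} A] {S : AdderData.{v, w, u} A}
  {M : Type (u + 1)} [Category.{u} M] (N : ModuleData S M)

/-- `f ⊠ g = ∑_f (g ∘ f^{M,♭})`. -/
abbrev boxTimes {U : Type (max w (u + 1))} [Category.{max v u} U] (m : U ⥤ M)
    (f : Tot N.fam m ⥤ A) (g : Tot N.fam (N.sum m f) ⥤ A) : Tot N.fam m ⥤ A :=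
  S.sum f (N.flat m f ⋙ g)

/-- The laws of a left module over a dependent adder in `hCAT`: equalities of morphisms of `hCAT`
are natural isomorphisms of functors. -/
structure IsLeftModule : Prop where
  /-- `f^{M,♭}` is a functor over `U`. -/
  flat_over {U : Type (max w (u + 1))} [Category.{max v u} U] (m : U ⥤ M) (f : Tot N.fam m ⥤ A) :
    N.flat m f ⋙ Tot.proj N.fam (N.sum m f) = Tot.proj S.fam f ⋙ Tot.proj N.fam m
  /-- The sum is natural in triangles over the base that commute up to an isomorphism `α`, and
  depends on the family only up to isomorphism `θ`; the flattening is compatible with this. -/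
  natural {U V : Type (max w (u + 1))} [Category.{max v u} U] [Category.{max v u} V]
    (g : U ⥤ V) (m : U ⥤ M) (n : V ⥤ M) (α : m ≅ g ⋙ n)
    (f : Tot N.fam m ⥤ A) (f' : Tot N.fam n ⥤ A) (θ : f ≅ Tot.change N.fam g α.hom ⋙ f') :
    ∃ σ : N.sum m f ≅ g ⋙ N.sum n f',
      IsoOver (Tot.proj N.fam (N.sum n f'))
        (N.flat m f ⋙ Tot.change N.fam g σ.hom)
        (Tot.change S.fam (Tot.change N.fam g α.hom) θ.hom ⋙ N.flat n f')
  /-- Unit axiom `∑_m 1 = m`. -/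
  unit {U : Type (max w (u + 1))} [Category.{max v u} U] (m : U ⥤ M) :
    Nonempty (N.sum m (S.constOne _) ≅ m)
  /-- Sum associativity (the isomorphism `σ`), and flatten associativity, i.e. commutativity of the
  square of flattening functors, where `⟦∑_{∑ f} g⟧` is identified with `⟦∑ ∑_f g ∘ f^♭⟧`
  along `σ`. -/
  assoc {U : Type (max w (u + 1))} [Category.{max v u} U] (m : U ⥤ M) (f : Tot N.fam m ⥤ A)
    (g : Tot N.fam (N.sum m f) ⥤ A) :
    ∃ σ : N.sum (N.sum m f) g ≅ N.sum m (N.boxTimes m f g),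
      IsoOver (Tot.proj N.fam (N.sum m (N.boxTimes m f g)))
        (S.flat f (N.flat m f ⋙ g) ⋙ N.flat m (N.boxTimes m f g))
        (Tot.pre S.fam (N.flat m f) g ⋙ N.flat (N.sum m f) g ⋙ Tot.map N.fam σ.hom)

end ModuleData

/-- In a Grothendieck construction with thin fibres a morphism is determined by its base. -/
theorem Tot.hom_ext {C : Type*} [Category* C] {F : C ⥤ Cat.{u, u}}
    (hF : ∀ (c : C) (a b : F.obj c), Subsingleton (a ⟶ b)) {p q : Grothendieck F} {k l : p ⟶ q}
    (h : k.base = l.base) : k = l :=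
  Grothendieck.ext k l h ((hF _ _ _).elim _ _)

theorem map_map_eq {C : Type*} [Category* C] (f : C ⥤ Type u) {a b c : C} (k : a ⟶ b) (l : b ⟶ c)
    (j : a ⟶ c) (h : k ≫ l = j) (r : f.obj a) : f.map l (f.map k r) = f.map j r := by
  subst h; simp

theorem map_eq_self {C : Type*} [Category* C] (f : C ⥤ Type u) {a : C} (k : a ⟶ a)
    (h : k = 𝟙 a) (r : f.obj a) : f.map k r = r := by
  subst h; simp

/-! ### The dependent adder `Set` -/

namespace SetAdder

variable {U : Type*} [Category* U] (x : U ⥤ Type u)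

theorem thin (c : U) (a b : (x ⋙ typeToCat).obj c) : Subsingleton (a ⟶ b) :=
  ⟨fun _ _ => ULift.ext _ _ (PLift.down_injective (Subsingleton.elim _ _))⟩

/-- The morphism `(a, t) ⟶ (b, t')` over `k : a ⟶ b`, for elements with `x(k)(t) = t'`. -/
def mkHom {a b : U} (k : a ⟶ b) {t : x.obj a} {t' : x.obj b} (h : x.map k t = t') :
    (⟨a, ⟨t⟩⟩ : Tot typeToCat x) ⟶ ⟨b, ⟨t'⟩⟩ :=
  ⟨k, (Discrete.eqToHom h : (⟨x.map k t⟩ : Discrete (x.obj b)) ⟶ ⟨t'⟩)⟩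

variable (f : Tot typeToCat x ⥤ Type u)

theorem sigma_ext {a : U} {t t' : x.obj a} {r : f.obj ⟨a, ⟨t⟩⟩} {r' : f.obj ⟨a, ⟨t'⟩⟩} (h : t = t')
    (k : (⟨a, ⟨t⟩⟩ : Tot typeToCat x) ⟶ ⟨a, ⟨t'⟩⟩) (hk : k.base = 𝟙 a) (hr : f.map k r = r') :
    (⟨t, r⟩ : Σ t : x.obj a, f.obj ⟨a, ⟨t⟩⟩) = ⟨t', r'⟩ := by
  subst h
  exact congrArg (Sigma.mk t) ((map_eq_self f k (Tot.hom_ext (thin x) hk) r).symm.trans hr)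

/-- The function `(t, a) ↦ (x(k)(t), f(k, id)(a))`. -/
def sumMap {a b : U} (k : a ⟶ b) (p : Σ t : x.obj a, f.obj ⟨a, ⟨t⟩⟩) :
    Σ t : x.obj b, f.obj ⟨b, ⟨t⟩⟩ :=
  ⟨x.map k p.1, f.map (mkHom x k rfl) p.2⟩

theorem sumMap_id (a : U) (p : Σ t : x.obj a, f.obj ⟨a, ⟨t⟩⟩) : sumMap x f (𝟙 a) p = p :=
  sigma_ext x f (map_eq_self x (𝟙 a) rfl p.1)
    (mkHom x (𝟙 a) ((map_eq_self x (𝟙 a) rfl _).trans (map_eq_self x (𝟙 a) rfl p.1))) rfl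
    ((map_map_eq f _ _ (𝟙 _) (Tot.hom_ext (thin x) (Category.comp_id _)) p.2).trans
      (map_eq_self f _ rfl p.2))

theorem sumMap_comp {a b c : U} (k : a ⟶ b) (l : b ⟶ c) (p : Σ t : x.obj a, f.obj ⟨a, ⟨t⟩⟩) :
    sumMap x f (k ≫ l) p = sumMap x f l (sumMap x f k p) :=
  have h : x.map (k ≫ l) p.1 = x.map l (x.map k p.1) := (map_map_eq x k l _ rfl p.1).symm
  sigma_ext x f h (mkHom x (𝟙 c) ((map_eq_self x (𝟙 c) rfl _).trans h)) rfl
    ((map_map_eq f _ _ (mkHom x (k ≫ l) h) (Tot.hom_ext (thin x) (Category.comp_id _)) p.2).trans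
      (map_map_eq f (mkHom x k rfl) (mkHom x l rfl) (mkHom x (k ≫ l) h)
        (Tot.hom_ext (thin x) rfl) p.2).symm)

/-- The dependent sum of sets: `u ↦ ∐_{t ∈ x(u)} f(u, t)`. -/
def sum : U ⥤ Type u where
  obj a := Σ t : x.obj a, f.obj ⟨a, ⟨t⟩⟩
  map k := ↾(sumMap x f k)
  map_id a := ConcreteCategory.hom_ext _ _ (sumMap_id x f a)
  map_comp k l := ConcreteCategory.hom_ext _ _ (sumMap_comp x f k l)

theorem flat_aux {p q : Tot typeToCat f} (k : p ⟶ q) :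
    sumMap x f k.base.base ⟨p.base.fiber.as, p.fiber.as⟩ = ⟨q.base.fiber.as, q.fiber.as⟩ :=
  have h : x.map k.base.base p.base.fiber.as = q.base.fiber.as := k.base.fiber.down.down
  sigma_ext x f h (mkHom x (𝟙 _) ((map_eq_self x (𝟙 _) rfl _).trans h)) rfl
    ((map_map_eq f _ _ k.base (Tot.hom_ext (thin x) (Category.comp_id _)) p.fiber.as).trans
      k.fiber.down.down)

/-- The flattening: `((u, t), a) ↦ (u, (t, a))`. -/
def flat : Tot typeToCat f ⥤ Tot typeToCat (sum x f) where
  obj p := ⟨p.base.base, ⟨⟨p.base.fiber.as, p.fiber.as⟩⟩⟩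
  map k := mkHom (sum x f) k.base.base (flat_aux x f k)
  map_id _ := Tot.hom_ext (thin _) rfl
  map_comp _ _ := Tot.hom_ext (thin _) rfl

end SetAdder

/-- The category of sets with the family of discrete categories, one-point sets as unit, coproducts
as sums. -/
def setAdder : AdderData.{v, w, u} (Type u) where
  fam := typeToCat
  unit := ⟨PUnit, ⟨PUnit.unit⟩⟩
  sum x f := SetAdder.sum x f
  flat x f := SetAdder.flat x f

/-! ### The left module `TopOpen` -/

namespace TopOpen

variable {D : Type*} [Category* D] (m : D ⥤ TopOpen.{u}) (f : Tot ouv m ⥤ Type u)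

theorem thin (d : D) (a b : (m ⋙ ouv).obj d) : Subsingleton (a ⟶ b) :=
  ⟨fun _ _ => Quiver.Hom.unop_inj (Subsingleton.elim _ _)⟩

/-- The presheaf `f ∘ ι_d` on `m(d)`. -/
def fibre (d : D) : Psh (m.obj d) :=
  Grothendieck.ι (m ⋙ ouv) d ⋙ f

/-- The morphism of presheaves `f ∘ ι_d ⟶ m(k)^* (f ∘ ι_e)` for `k : d ⟶ e`. -/
def fibreMap {d e : D} (k : d ⟶ e) : fibre m f d ⟶ pull (m.map k) (fibre m f e) :=
  Functor.whiskerRight (Grothendieck.ιNatTrans k) f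

/-- Two sections of `f` related by a morphism over an identity have the same germs. -/
theorem germ_eq_of_hom {d : D} {V W : Opens (m.obj d).space} (j : op V ⟶ op W)
    (k : (⟨d, op V⟩ : Tot ouv m) ⟶ ⟨d, op W⟩) (hk : k.base = 𝟙 d) (x : (m.obj d).space)
    (hx : x ∈ W) (s : (fibre m f d).obj (op V)) :
    (fibre m f d).germ W x hx (f.map k s) = (fibre m f d).germ V x (j.unop.le hx) s := by
  have h : k = (Grothendieck.ι (m ⋙ ouv) d).map j := Tot.hom_ext (thin m) hk
  rw [h]
  exact TopCat.Presheaf.germ_res_apply' (fibre m f d) j x hx s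

theorem mk_germ_eq {d : D} {V W : Opens (m.obj d).space} (e : V = W)
    (k : (⟨d, op V⟩ : Tot ouv m) ⟶ ⟨d, op W⟩) (hk : k.base = 𝟙 d) {x y : (m.obj d).space}
    (hxy : x = y) (hx : x ∈ V) (hy : y ∈ W) (s : (fibre m f d).obj (op V))
    (t : (fibre m f d).obj (op W)) (hst : f.map k s = t) :
    (TopCat.Presheaf.EtaleSpace.mk x ((fibre m f d).germ V x hx s) : (fibre m f d).EtaleSpace) =
      TopCat.Presheaf.EtaleSpace.mk y ((fibre m f d).germ W y hy t) := by
  subst hxy hst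
  exact congrArg (TopCat.Presheaf.EtaleSpace.mk x)
    (germ_eq_of_hom m f (eqToHom (by rw [e])) k hk x hy s).symm

/-- The morphism `(d, V) ⟶ (d, W)` for `W ⊆ V`, up to the identification of `m(𝟙 d)(V)` with `V`. -/
def mkHom {d e : D} (k : d ⟶ e) (V : Opens (m.obj d).space) (W : Opens (m.obj e).space)
    (h : W ≤ image (m.map k) V) : (⟨d, op V⟩ : Tot ouv m) ⟶ ⟨e, op W⟩ :=
  ⟨k, (homOfLE h).op⟩

theorem image_map_id (d : D) (U : Opens (m.obj d).space) : image (m.map (𝟙 d)) U = U := by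
  rw [m.map_id]; exact Opens.ext (Set.image_id _)

theorem image_map_comp {a b c : D} (k : a ⟶ b) (l : b ⟶ c) (U : Opens (m.obj a).space) :
    image (m.map (k ≫ l)) U = image (m.map l) (image (m.map k) U) := by
  rw [m.map_comp]; exact Opens.ext (Set.image_comp (m.map l).toFun (m.map k).toFun _)

theorem sum_map_id (d : D) : etMap (m.map (𝟙 d)) (fibreMap m f (𝟙 d)) = 𝟙 (et (fibre m f d)) := by
  refine et_hom_ext fun U x hx s => (etMap_germ _ _ U x hx s).trans ?_
  refine mk_germ_eq m f (image_map_id m d U)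
    (mkHom m (𝟙 d) (image (m.map (𝟙 d)) U) U (by rw [image_map_id, image_map_id])) rfl
    (by rw [m.map_id]; rfl) _ hx _ _ ?_
  exact (map_map_eq f _ _ (𝟙 _) (Tot.hom_ext (thin m) (Category.comp_id _)) s).trans
      (map_eq_self f _ rfl s)

theorem sum_map_comp {a b c : D} (k : a ⟶ b) (l : b ⟶ c) :
    etMap (m.map (k ≫ l)) (fibreMap m f (k ≫ l)) =
      etMap (m.map k) (fibreMap m f k) ≫ etMap (m.map l) (fibreMap m f l) := by
  refine et_hom_ext fun U x hx s => (etMap_germ _ _ U x hx s).trans ?_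
  refine Eq.trans ?_ ((congrArg (etMap (m.map l) (fibreMap m f l)).toFun
    (etMap_germ _ (fibreMap m f k) U x hx s)).trans (etMap_germ _ _ _ _ _ _)).symm
  refine mk_germ_eq m f (image_map_comp m k l U)
    (mkHom m (𝟙 c) _ _ (by rw [image_map_id, image_map_comp])) rfl
    (by rw [m.map_comp]; rfl) _ _ _ _ ?_
  exact (map_map_eq f _ _ _ rfl s).trans ((map_map_eq f _ _ _
    (Tot.hom_ext (thin m) (Category.comp_id _).symm) s)).symm

/-- The dependent sum: `d ↦ Et(f ∘ ι_d)`. -/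
noncomputable def sum : D ⥤ TopOpen.{u} where
  obj d := et (fibre m f d)
  map k := etMap (m.map k) (fibreMap m f k)
  map_id d := sum_map_id m f d
  map_comp k l := sum_map_comp m f k l

theorem flat_aux {p q : Tot typeToCat f} (k : p ⟶ q) :
    eps (fibre m f q.base.base) q.base.fiber.unop q.fiber.as ≤
      image ((sum m f).map k.base.base)
        (eps (fibre m f p.base.base) p.base.fiber.unop p.fiber.as) := by
  refine le_of_le_of_eq ?_ (etMap_image _ (fibreMap m f k.base.base) _ p.fiber.as).symm
  have h : f.map k.base p.fiber.as = q.fiber.as := k.fiber.down.down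
  have hk : mkHom m k.base.base p.base.fiber.unop (image (m.map k.base.base) p.base.fiber.unop)
      le_rfl ≫ (Grothendieck.ι (m ⋙ ouv) q.base.base).map k.base.fiber = k.base :=
    Tot.hom_ext (thin m) (Category.comp_id _)
  have h' := (map_map_eq f _ _ _ hk p.fiber.as).trans h
  exact h' ▸ eps_res (fibre m f q.base.base) k.base.fiber _

/-- The flattening: `((d, U), s) ↦ (d, ε(U, s))`. -/
noncomputable def flat : Tot typeToCat f ⥤ Tot ouv (sum m f) where
  obj p := ⟨p.base.base, op (eps (fibre m f p.base.base) p.base.fiber.unop p.fiber.as)⟩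
  map k := ⟨k.base.base, (homOfLE (flat_aux m f k)).op⟩
  map_id _ := Tot.hom_ext (thin _) rfl
  map_comp _ _ := Tot.hom_ext (thin _) rfl

end TopOpen

/-- Topological spaces and open maps, with the family of posets of open sets with reverse inclusion,
étalé spaces as sums and `(U, s) ↦ ε(U, s)` as flattening. -/
noncomputable def topOpenModule : ModuleData setAdder.{v, w, u} TopOpen.{u} where
  fam := TopOpen.ouv
  sum m f := TopOpen.sum m f
  flat m f := TopOpen.flat m f

namespace TopOpen

theorem pull_id {X : TopOpen.{u}} (F : Psh X) : pull (𝟙 X) F = F := by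
  unfold pull; rw [ouv.map_id]; rfl

theorem pull_comp {X Y Z : TopOpen.{u}} (k : X ⟶ Y) (l : Y ⟶ Z) (F : Psh Z) :
    pull k (pull l F) = pull (k ≫ l) F := by
  unfold pull; rw [ouv.map_comp]; rfl

/-- The pullback of a morphism of presheaves along an open map. -/
def pullMap {X Y : TopOpen.{u}} (k : X ⟶ Y) {F G : Psh Y} (τ : F ⟶ G) : pull k F ⟶ pull k G :=
  Functor.whiskerLeft (ouv.map k).toFunctor τ

/-- The point `(x, s)` of `Et(F)`. -/
def pt {X : TopOpen.{u}} {F : Psh X} (x : X.space) (s : F.stalk x) : (et F).space :=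
  (TopCat.Presheaf.EtaleSpace.mk x s : F.EtaleSpace)

/-- The underlying point `x` of a point `(x, s)` of `Et(F)`. -/
def base {X : TopOpen.{u}} {F : Psh X} (p : (et F).space) : X.space :=
  TopCat.Presheaf.EtaleSpace.base (F := F) p

/-- The element `s` of the stalk at `x` of a point `(x, s)` of `Et(F)`. -/
def germAt {X : TopOpen.{u}} {F : Psh X} (p : (et F).space) : F.stalk (base p) :=
  TopCat.Presheaf.EtaleSpace.germ (F := F) p

/-- The set `∐_{s ∈ F(V)} G(ε(V, s))`. -/
abbrev BoxObj {X : TopOpen.{u}} (F : Psh X) (G : Psh (et F)) (V : Opens X.space) : Type u :=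
  Σ s : F.obj (op V), G.obj (op (eps F V s))

theorem box_ext {X : TopOpen.{u}} {F : Psh X} {G : Psh (et F)} {V : Opens X.space}
    {s s' : F.obj (op V)} {t : G.obj (op (eps F V s))} {t' : G.obj (op (eps F V s'))} (h : s = s')
    (i : op (eps F V s) ⟶ op (eps F V s')) (ht : G.map i t = t') :
    (⟨s, t⟩ : BoxObj F G V) = ⟨s', t'⟩ := by
  subst h
  exact congrArg (Sigma.mk s)
    ((map_eq_self G i (Quiver.Hom.unop_inj (Subsingleton.elim _ _)) t).symm.trans ht)

/-- The restriction `(s, t) ↦ (s|_W, t|_{ε(W, s|_W)})`. -/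
def boxRes {X : TopOpen.{u}} (F : Psh X) (G : Psh (et F)) {V W : (Opens X.space)ᵒᵖ} (i : V ⟶ W)
    (p : BoxObj F G V.unop) : BoxObj F G W.unop :=
  ⟨F.map i p.1, G.map (homOfLE (eps_res F i p.1)).op p.2⟩

theorem boxRes_id {X : TopOpen.{u}} (F : Psh X) (G : Psh (et F)) (V : (Opens X.space)ᵒᵖ)
    (p : BoxObj F G V.unop) : boxRes F G (𝟙 V) p = p :=
  have h : F.map (𝟙 V) p.1 = p.1 := map_eq_self F (𝟙 V) rfl p.1
  box_ext h (eqToHom (congrArg (fun s => op (eps F V.unop s)) h))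
    ((map_map_eq G _ _ (𝟙 _) (Quiver.Hom.unop_inj (Subsingleton.elim _ _)) p.2).trans
      (map_eq_self G _ rfl p.2))

theorem boxRes_comp {X : TopOpen.{u}} (F : Psh X) (G : Psh (et F)) {V W T : (Opens X.space)ᵒᵖ}
    (i : V ⟶ W) (j : W ⟶ T) (p : BoxObj F G V.unop) :
    boxRes F G (i ≫ j) p = boxRes F G j (boxRes F G i p) :=
  have h : F.map (i ≫ j) p.1 = F.map j (F.map i p.1) := (map_map_eq F i j _ rfl p.1).symm
  box_ext h (eqToHom (congrArg (fun s => op (eps F T.unop s)) h))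
    ((map_map_eq G _ _ _ rfl p.2).trans (map_map_eq G _ _ _
      (Quiver.Hom.unop_inj (Subsingleton.elim _ _)) p.2).symm)

/-- For a presheaf `F` on `X` and a presheaf `G` on `Et(F)`, the presheaf `F ⊠ G` on `X`,
`V ↦ ∐_{s ∈ F(V)} G(ε(V, s))`. -/
def box {X : TopOpen.{u}} (F : Psh X) (G : Psh (et F)) : Psh X where
  obj V := BoxObj F G V.unop
  map i := ↾(boxRes F G i)
  map_id V := ConcreteCategory.hom_ext _ _ (boxRes_id F G V)
  map_comp i j := ConcreteCategory.hom_ext _ _ (boxRes_comp F G i j)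

/-- An open map `k : X → X'` and morphisms of presheaves `τ : F ⟶ k^* F'` and
`ρ : G ⟶ Et(k, τ)^* G'` induce maps `(F ⊠ G)(V) → (F' ⊠ G')(k(V))`, `(s, t) ↦ (τ(s), ρ(t))`;
note that `Et(k, τ)` maps `ε(V, s)` onto `ε(k(V), τ(s))`. -/
noncomputable def boxMapFun {X X' : TopOpen.{u}} (k : X ⟶ X') {F : Psh X} {G : Psh (et F)}
    {F' : Psh X'} {G' : Psh (et F')} (τ : F ⟶ pull k F') (ρ : G ⟶ pull (etMap k τ) G')
    (V : Opens X.space) (p : BoxObj F G V) : BoxObj F' G' (image k V) :=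
  ⟨τ.app (op V) p.1,
    G'.map (homOfLE (etMap_image k τ V p.1).ge).op (ρ.app (op (eps F V p.1)) p.2)⟩

theorem boxMapFun_res {X X' : TopOpen.{u}} (k : X ⟶ X') {F : Psh X} {G : Psh (et F)}
    {F' : Psh X'} {G' : Psh (et F')} (τ : F ⟶ pull k F') (ρ : G ⟶ pull (etMap k τ) G')
    {V W : (Opens X.space)ᵒᵖ} (i : V ⟶ W) (p : BoxObj F G V.unop) :
    boxMapFun k τ ρ W.unop (boxRes F G i p) =
      boxRes F' G' ((imageFunctor k).op.map i) (boxMapFun k τ ρ V.unop p) := by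
  have h : τ.app W (F.map i p.1) = F'.map ((imageFunctor k).op.map i) (τ.app V p.1) :=
    ConcreteCategory.congr_hom (τ.naturality i) p.1
  refine box_ext (F := F') (G := G') (V := image k W.unop) h
    (eqToHom (congrArg (fun s => op (eps F' (image k W.unop) s)) h)) ?_
  have h' : ρ.app (op (eps F W.unop (F.map i p.1)))
        (G.map (homOfLE (eps_res F i p.1)).op p.2) =
      G'.map ((imageFunctor (etMap k τ)).op.map (homOfLE (eps_res F i p.1)).op)
        (ρ.app (op (eps F V.unop p.1)) p.2) :=
    ConcreteCategory.congr_hom (ρ.naturality (homOfLE (eps_res F i p.1)).op) p.2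
  refine ((map_map_eq G' _ _ _ rfl _).trans ((congrArg _ h').trans
    (map_map_eq G' _ _ _ rfl _))).trans (Eq.symm ?_)
  exact map_map_eq G' _ _ _ (Quiver.Hom.unop_inj (Subsingleton.elim _ _)) _

/-- The morphism of presheaves `F ⊠ G ⟶ k^* (F' ⊠ G')`. -/
noncomputable def boxMap {X X' : TopOpen.{u}} (k : X ⟶ X') {F : Psh X} {G : Psh (et F)}
    {F' : Psh X'} {G' : Psh (et F')} (τ : F ⟶ pull k F') (ρ : G ⟶ pull (etMap k τ) G') :
    box F G ⟶ pull k (box F' G') where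
  app V := ↾(boxMapFun k τ ρ V.unop)
  naturality _ _ i := ConcreteCategory.hom_ext _ _ (boxMapFun_res k τ ρ i)

end TopOpen

/-!
All the fibre categories involved (discrete categories, posets of open sets) are thin, so a morphism
of a category `⟦x⟧` is determined by its image in the base. Two functors into `⟦x⟧` that have the same
values on objects and the same projection to the base are therefore equal
(`Tot.isoOver_of_thin`), and each law about flattenings reduces to an identity between elements
or between open sets.

For `Set` the isomorphisms required by the laws are the canonical bijections of disjoint unions
(`Equiv.sigmaCongr`, `Equiv.sigmaPUnit`, `Equiv.uniqueSigma`, `Equiv.sigmaAssoc`), and the two sides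
of each law about flattenings agree on objects by definition.

For `TopOpen`, naturality comes from the functoriality of `Et` in presheaves and in open maps: an
isomorphism `k` and an isomorphism `F ≅ k^* G` induce an isomorphism `Et(F) ≅ Et(G)`
(`TopOpen.isIso_etMap`). The unit law holds because the projection `Et(1) → X` is a homeomorphism
(`TopOpen.isIso_etProj`). Associativity is the homeomorphism `Et(G) ≅ Et(F ⊠ G)`. On stalks it is the
bijection `(F ⊠ G)_x ≅ ∐_{s ∈ F_x} G_{(x, s)}` (`TopOpen.boxStalkEquiv`), whose bijectivity rests on
the fact that a neighbourhood of the germ `s_x` in `Et(F)` contains `ε(V, s|_V)` for some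
neighbourhood `V` of `x` (`TopOpen.exists_eps_le`). By the same fact the sets `ε(ε(U, s), t)` form a
basis of the topology of `Et(G)` (`TopOpen.exists_eps_eps_le`), and the bijection maps them to the
basic open sets `ε(U, (s, t))`, so it is a homeomorphism. The laws about flattenings say that the
isomorphisms map sets of germs of sections to sets of germs of sections.
-/

/-! ### Thin fibres and the dependent adder of sets -/

namespace Tot

theorem hom_heq_of_thin {C : Type*} [Category* C] {F : C ⥤ Cat.{u, u}}
    (hF : ∀ (c : C) (a b : F.obj c), Subsingleton (a ⟶ b)) {p q p' q' : Grothendieck F}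
    (hp : p = p') (hq : q = q') {k : p ⟶ q} {l : p' ⟶ q'} (h : k.base ≍ l.base) : k ≍ l := by
  subst hp hq
  exact heq_of_eq (hom_ext hF (eq_of_heq h))

/-- Two functors into a Grothendieck construction with thin fibres that agree on objects and over
the base are equal, hence isomorphic over the base. -/
theorem isoOver_of_thin {B C : Type*} [Category* B] [Category* C] {F : C ⥤ Cat.{u, u}}
    (hF : ∀ (c : C) (a b : F.obj c), Subsingleton (a ⟶ b)) {G H : B ⥤ Grothendieck F}
    (ho : ∀ b, G.obj b = H.obj b) (h : G ⋙ Grothendieck.forget F = H ⋙ Grothendieck.forget F) :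
    IsoOver (Grothendieck.forget F) G H := by
  obtain rfl : G = H := CategoryTheory.Functor.hext ho fun a b k =>
    hom_heq_of_thin hF (ho a) (ho b) (CategoryTheory.Functor.hcongr_hom h k)
  exact ⟨Iso.refl _, rfl, by simp⟩

end Tot

namespace SetAdder

section
variable {U : Type*} [Category* U] {V : Type*} [Category* V] {x : U ⥤ Type u} {y : V ⥤ Type u}

/-- `∑_x f ≅ (∑_y f') ∘ g`, `(t, r) ↦ (α(t), θ(r))`. -/
def sumCongr (g : U ⥤ V) (α : x ≅ g ⋙ y) (f : Tot typeToCat x ⥤ Type u)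
    (f' : Tot typeToCat y ⥤ Type u) (θ : f ≅ Tot.change typeToCat g α.hom ⋙ f') :
    sum x f ≅ g ⋙ sum y f' :=
  NatIso.ofComponents
    (fun a => Equiv.toIso (Equiv.sigmaCongr (α.app a).toEquiv fun t => (θ.app ⟨a, ⟨t⟩⟩).toEquiv))
    (fun {a b} k => ConcreteCategory.hom_ext _ _ fun p => by
      have hα : α.hom.app b (x.map k p.1) = y.map (g.map k) (α.hom.app a p.1) :=
        ConcreteCategory.congr_hom (α.hom.naturality k) p.1
      have hθ := ConcreteCategory.congr_hom (θ.hom.naturality (mkHom x k (t := p.1) rfl)) p.2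
      refine sigma_ext y f' hα (mkHom y (𝟙 (g.obj b)) ((map_eq_self y _ rfl _).trans hα)) rfl ?_
      refine (congrArg _ hθ).trans ?_
      exact map_map_eq f' _ _ _ (Tot.hom_ext (thin y) (Category.comp_id _)) _)

/-- `∑_x 1 ≅ x`. -/
def sumOne (x : U ⥤ Type u) :
    sum x ((Functor.const (Tot typeToCat x)).obj PUnit.{u + 1}) ≅ x :=
  NatIso.ofComponents (fun a => Equiv.toIso (Equiv.sigmaPUnit (x.obj a)))
    (fun _ => rfl)

/-- `∑_1 (f ∘ ⟦ρ⟧ ∘ 1^♭) ≅ f` for the isomorphism `ρ : ∑_x 1 ≅ x`. -/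
def oneSum (x : U ⥤ Type u) (f : Tot typeToCat x ⥤ Type u) :
    sum ((Functor.const (Tot typeToCat x)).obj PUnit.{u + 1})
      (flat x _ ⋙ Tot.map typeToCat (sumOne x).hom ⋙ f) ≅ f :=
  NatIso.ofComponents (fun p => Equiv.toIso (Equiv.uniqueSigma fun _ : PUnit.{u + 1} => f.obj p))
    (fun {p q} k => ConcreteCategory.hom_ext _ _ fun r =>
      have h (l : p ⟶ q) (hl : l.base = k.base) (r : f.obj p) : f.map l r = f.map k r := by
        rw [Tot.hom_ext (thin x) hl]
      h ((flat x _ ⋙ Tot.map typeToCat (sumOne x).hom).map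
        (mkHom ((Functor.const (Tot typeToCat x)).obj PUnit.{u + 1}) k rfl)) rfl r.2)

/-- `∑_{∑_x f} g ≅ ∑_x ∑_f (g ∘ f^♭)`, `((t, r), s) ↦ (t, (r, s))`. -/
def sumAssoc (x : U ⥤ Type u) (f : Tot typeToCat x ⥤ Type u)
    (g : Tot typeToCat (sum x f) ⥤ Type u) :
    sum (sum x f) g ≅ sum x (sum f (flat x f ⋙ g)) :=
  NatIso.ofComponents
    (fun a => Equiv.toIso (Equiv.sigmaAssoc fun t r => g.obj ⟨a, ⟨⟨t, r⟩⟩⟩))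
    (fun _ => rfl)
end

end SetAdder

theorem setAdder_isDependentAdder : setAdder.{v, w, u}.IsDependentAdder where
  flat_over _ _ := rfl
  natural g _ _ α f f' θ := ⟨SetAdder.sumCongr g α f f' θ,
    Tot.isoOver_of_thin (SetAdder.thin _) (fun _ => rfl) rfl⟩
  unit x := ⟨SetAdder.sumOne x, fun f => ⟨SetAdder.oneSum x f⟩⟩
  assoc x f g := ⟨SetAdder.sumAssoc x f g,
    Tot.isoOver_of_thin (SetAdder.thin _) (fun _ => rfl) rfl⟩

/-! ### Functoriality of étalé spaces -/

namespace TopOpen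

theorem etPsh_id {X : TopOpen.{u}} (F : Psh X) : etPsh (𝟙 F) = 𝟙 (et F) :=
  et_hom_ext fun U x hx s => etPshFun_germ (𝟙 F) U x hx s

theorem etPsh_comp {X : TopOpen.{u}} {F G H : Psh X} (τ : F ⟶ G) (ρ : G ⟶ H) :
    etPsh (τ ≫ ρ) = etPsh τ ≫ etPsh ρ :=
  et_hom_ext fun U x hx s => (etPshFun_germ (τ ≫ ρ) U x hx s).trans
    ((congrArg (etPshFun ρ) (etPshFun_germ τ U x hx s)).trans (etPshFun_germ ρ U x hx _)).symm

theorem etPsh_image {X : TopOpen.{u}} {F G : Psh X} (τ : F ⟶ G) (U : Opens X.space)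
    (s : F.obj (op U)) : image (etPsh τ) (eps F U s) = eps G U (τ.app (op U) s) :=
  Opens.ext (etPshFun_image τ U s)

theorem etPull_image {X Y : TopOpen.{u}} (k : X ⟶ Y) (F : Psh Y) (U : Opens X.space)
    (s : F.obj (op (image k U))) :
    image (etPull k F) (eps (pull k F) U s) = eps F (image k U) s :=
  Opens.ext (etPullFun_image k F U s)

theorem etPull_naturality {X Y : TopOpen.{u}} (k : X ⟶ Y) {F G : Psh Y} (τ : F ⟶ G) :
    etPull k F ≫ etPsh τ = etPsh (pullMap k τ) ≫ etPull k G :=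
  et_hom_ext fun U x hx s =>
    ((congrArg (etPshFun τ) (etPullFun_germ k F U x hx s)).trans (etPshFun_germ τ _ _ _ _)).trans
    ((congrArg (etPullFun k G) (etPshFun_germ (pullMap k τ) U x hx s)).trans
      (etPullFun_germ k G U x hx _)).symm

/-- Restriction along an equality of open sets does not change the germs of a section. -/
theorem pt_germ_eqToHom {X : TopOpen.{u}} (F : Psh X) {U V : Opens X.space} (h : U = V)
    {x y : X.space} (hxy : x = y) (hx : x ∈ U) (hy : y ∈ V) (s : F.obj (op U)) :
    (pt x (F.germ U x hx s) : (et F).space) =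
      pt y (F.germ V y hy (F.map (eqToHom (congrArg op h)) s)) := by
  subst h hxy
  simp

theorem etPull_id {Y : TopOpen.{u}} (F : Psh Y) :
    etPull (𝟙 Y) F = etPsh (eqToHom (pull_id F)) := by
  refine et_hom_ext fun U x hx s => (etPullFun_germ (𝟙 Y) F U x hx s).trans
    (Eq.trans ?_ (etPshFun_germ _ U x hx s).symm)
  have h : image (𝟙 Y) U = U := Opens.ext (Set.image_id _)
  rw [eqToHom_app]
  refine (pt_germ_eqToHom F h rfl _ hx s).trans ?_
  rw [eqToHom_map]
  rfl

theorem etPull_comp {W X Y : TopOpen.{u}} (l : W ⟶ X) (k : X ⟶ Y) (F : Psh Y) :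
    etPull l (pull k F) ≫ etPull k F =
      etPsh (eqToHom (pull_comp l k F)) ≫ etPull (l ≫ k) F := by
  refine et_hom_ext fun U x hx s => ((congrArg (etPullFun k F)
    (etPullFun_germ l (pull k F) U x hx s)).trans (etPullFun_germ k F _ _ _ _)).trans
    (Eq.trans ?_ ((congrArg (etPullFun (l ≫ k) F) (etPshFun_germ _ U x hx s)).trans
      (etPullFun_germ (l ≫ k) F U x hx _)).symm)
  have h : image k (image l U) = image (l ≫ k) U :=
    Opens.ext (Set.image_comp k.toFun l.toFun _).symm
  rw [eqToHom_app]
  refine (pt_germ_eqToHom F h rfl _ ⟨x, hx, rfl⟩ s).trans ?_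
  rw [eqToHom_map]
  rfl

/-- The functor `Et` from presheaves on `X` to topological spaces and open maps. -/
noncomputable def etFunctor (X : TopOpen.{u}) : Psh X ⥤ TopOpen.{u} where
  obj F := et F
  map τ := etPsh τ
  map_id := etPsh_id
  map_comp := etPsh_comp

instance {X : TopOpen.{u}} {F G : Psh X} (τ : F ⟶ G) [IsIso τ] : IsIso (etPsh τ) :=
  inferInstanceAs (IsIso ((etFunctor X).map τ))

theorem isIso_etPull_inv_comp {X Y : TopOpen.{u}} (k : X ⟶ Y) [IsIso k] (F : Psh Y) :
    IsIso (etPull (inv k) (pull k F) ≫ etPull k F) := by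
  have h (l : Y ⟶ Y) (hl : l = 𝟙 Y) : IsIso (etPull l F) := by
    subst hl
    rw [etPull_id]
    infer_instance
  have := h (inv k ≫ k) (IsIso.inv_hom_id k)
  rw [etPull_comp]
  infer_instance

theorem isSplitEpi_etPull {X Y : TopOpen.{u}} (k : X ⟶ Y) [IsIso k] (F : Psh Y) :
    IsSplitEpi (etPull k F) :=
  have := isIso_etPull_inv_comp k F
  ⟨⟨⟨inv (etPull (inv k) (pull k F) ≫ etPull k F) ≫ etPull (inv k) (pull k F), by simp⟩⟩⟩

/-- `Et(k^* F) → Et(F)` is an isomorphism if `k` is: the map for `k⁻¹` is a split epimorphism, and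
it is a monomorphism as its composite with the map for `k` is an isomorphism. -/
instance isIso_etPull {X Y : TopOpen.{u}} (k : X ⟶ Y) [IsIso k] (F : Psh Y) :
    IsIso (etPull k F) := by
  have := isIso_etPull_inv_comp k F
  have := isSplitEpi_etPull (inv k) (pull k F)
  have : Mono (etPull (inv k) (pull k F)) := mono_of_mono _ (etPull k F)
  have : IsIso (etPull (inv k) (pull k F)) := isIso_of_mono_of_isSplitEpi _
  exact IsIso.of_isIso_comp_left (etPull (inv k) (pull k F)) (etPull k F)

instance isIso_etMap {X Y : TopOpen.{u}} (k : X ⟶ Y) [IsIso k] {F : Psh X} {G : Psh Y}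
    (τ : F ⟶ pull k G) [IsIso τ] : IsIso (etMap k τ) :=
  inferInstanceAs (IsIso (etPsh τ ≫ etPull k G))

/-- A continuous open map `k` induces continuous maps of étalé spaces: if `t` is the section of
`G` whose germs are prescribed and `τ(s)` has germ `t_{k(x)}` at `k(x)`, then the two sections
agree on a neighbourhood `W` of `k(x)`, and the germs of `s` over `k⁻¹(W)` are mapped to germs of
`t`. -/
theorem continuous_etMap {X Y : TopOpen.{u}} (k : X ⟶ Y) (hk : Continuous k.toFun) {F : Psh X}
    {G : Psh Y} (τ : F ⟶ pull k G) : Continuous (etMap k τ).toFun := by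
  refine continuous_generateFrom_iff.2 ?_
  rintro _ ⟨V, t, rfl⟩
  refine isOpen_iff_forall_mem_open.2 ?_
  rintro ⟨x, e⟩ he
  obtain ⟨U, hx, s, rfl⟩ := F.exists_germ_eq e
  have he' : (etMap k τ).toFun (TopCat.Presheaf.EtaleSpace.mk x (F.germ U x hx s)) ∈
    epsSet G V t := he
  rw [etMap_germ] at he'
  obtain ⟨hV, hg⟩ := he'
  obtain ⟨W, hW, iU, iV, hst⟩ := G.germ_eq (k.toFun x) _ hV _ _ hg
  let U' : Opens X.space := U ⊓ ⟨k.toFun ⁻¹' W, W.isOpen.preimage hk⟩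
  let i : U' ⟶ U := homOfLE inf_le_left
  refine ⟨eps F U' (F.map i.op s), ?_, (eps F U' (F.map i.op s)).isOpen, ?_⟩
  · intro y hy
    obtain ⟨y, hyU, rfl⟩ := (mem_epsSet _ _ _ _).1 hy
    rw [TopCat.Presheaf.germ_res_apply]
    change (etMap k τ).toFun (TopCat.Presheaf.EtaleSpace.mk y (F.germ U y hyU.1 s)) ∈ epsSet G V t
    rw [etMap_germ]
    refine ⟨iV.le hyU.2, ?_⟩
    refine (TopCat.Presheaf.germ_res_apply G iU (k.toFun y) hyU.2 _).symm.trans ?_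
    rw [hst]
    exact TopCat.Presheaf.germ_res_apply G iV (k.toFun y) hyU.2 _
  · exact ⟨⟨hx, hW⟩, (TopCat.Presheaf.germ_res_apply F i x ⟨hx, hW⟩ s).symm⟩

/-- The projection `Et(F) → X`, which maps `ε(U, s)` onto `U`. -/
noncomputable def etProj {X : TopOpen.{u}} (F : Psh X) : et F ⟶ X :=
  ⟨TopCat.Presheaf.EtaleSpace.base, isOpenMap_of_epsSet F _ fun U s => by
    convert U.isOpen
    ext x
    constructor
    · rintro ⟨_, ⟨h, _⟩, rfl⟩
      exact h
    · exact fun h => ⟨⟨x, F.germ U x h s⟩, ⟨h, rfl⟩, rfl⟩⟩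

end TopOpen

/-! ### The étalé space of `F ⊠ G` -/

namespace TopOpen

variable {X : TopOpen.{u}}

/-- A neighbourhood of the germ of `s` at `x` contains the germs of a restriction of `s`. -/
theorem exists_eps_le (F : Psh X) {U : Opens X.space} (s : F.obj (op U)) {x : X.space} (hx : x ∈ U)
    (W : Opens (et F).space) (hW : pt x (F.germ U x hx s) ∈ W) :
    ∃ (V : Opens X.space) (_ : x ∈ V) (i : V ⟶ U), eps F V (F.map i.op s) ≤ W := by
  have hV : image (etProj F) (eps F U s ⊓ W) ≤ U := by
    rintro _ ⟨e, ⟨he, _⟩, rfl⟩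
    exact he.1
  refine ⟨image (etProj F) (eps F U s ⊓ W), ⟨_, ⟨⟨hx, rfl⟩, hW⟩, rfl⟩, homOfLE hV, ?_⟩
  rintro ⟨y, e⟩ ⟨hy, he⟩
  obtain ⟨⟨z, e'⟩, ⟨⟨hz, he'⟩, heW⟩, hzy⟩ := hy
  obtain rfl : z = y := hzy
  have h : e = e' := (he.trans (TopCat.Presheaf.germ_res_apply' F (homOfLE hV).op z _ s)).trans
    he'.symm
  rw [h]
  exact heW

/-- Germs of one section at equal points are equal, up to the identification of the stalks. -/
theorem germ_heq {Y : TopOpen.{u}} (G : Psh Y) {W : Opens Y.space} {p q : Y.space} (h : p = q)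
    (hp : p ∈ W) (hq : q ∈ W) (t : G.obj (op W)) : G.germ W p hp t ≍ G.germ W q hq t := by
  subst h
  rfl

variable (F : Psh X) (G : Psh (et F))

/-- The map `(s, t) ↦ (s_x, t_{(x, s_x)})` on sections of `F ⊠ G` over a neighbourhood of `x`. -/
noncomputable def boxGerm (U : Opens X.space) (x : X.space) (hx : x ∈ U) (p : BoxObj F G U) :
    Σ s : F.stalk x, G.stalk (pt x s) :=
  ⟨F.germ U x hx p.1, G.germ (eps F U p.1) (pt x (F.germ U x hx p.1)) ⟨hx, rfl⟩ p.2⟩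

/-- `boxGerm` is compatible with restriction, so it descends to the stalk of `F ⊠ G`. -/
theorem boxGerm_res {U V : Opens X.space} (i : op U ⟶ op V) (x : X.space) (hx : x ∈ V)
    (p : BoxObj F G U) :
    boxGerm F G V x hx (boxRes F G i p) = boxGerm F G U x (i.unop.le hx) p := by
  have h : F.germ V x hx (F.map i p.1) = F.germ U x (i.unop.le hx) p.1 :=
    TopCat.Presheaf.germ_res_apply' F i x hx p.1
  refine Sigma.ext h ?_
  refine (heq_of_eq (TopCat.Presheaf.germ_res_apply' G (homOfLE (eps_res F i p.1)).op _ _ p.2)).trans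
    (germ_heq G (congrArg (pt x) h) _ _ p.2)

/-- The map `(F ⊠ G)_x → ∐_{s ∈ F_x} G_{(x, s)}`. -/
noncomputable def boxStalkMap (x : X.space) (e : (box F G).stalk x) :
    Σ s : F.stalk x, G.stalk (pt x s) :=
  Limits.colimit.desc ((OpenNhds.inclusion x).op ⋙ box F G)
    { pt := Σ s : F.stalk x, G.stalk (pt x s)
      ι :=
        { app := fun U => ↾(boxGerm F G U.unop.1 x U.unop.2)
          naturality := fun _ V i => ConcreteCategory.hom_ext _ _ fun p =>
            boxGerm_res F G ((OpenNhds.inclusion x).op.map i) x V.unop.2 p } } e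

theorem boxStalkMap_germ (U : Opens X.space) (x : X.space) (hx : x ∈ U) (p : BoxObj F G U) :
    boxStalkMap F G x ((box F G).germ U x hx p) = boxGerm F G U x hx p :=
  ConcreteCategory.congr_hom (Limits.colimit.ι_desc (F := (OpenNhds.inclusion x).op ⋙ box F G)
    _ (op ⟨U, hx⟩)) p

theorem box_germ_res {U V : Opens X.space} (i : V ⟶ U) (x : X.space) (hx : x ∈ V)
    (p : BoxObj F G U) :
    (box F G).germ V x hx (boxRes F G i.op p) = (box F G).germ U x (i.le hx) p :=
  TopCat.Presheaf.germ_res_apply (box F G) i x hx p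

theorem boxStalkMap_surjective (x : X.space) : Function.Surjective (boxStalkMap F G x) := by
  rintro ⟨s, t⟩
  obtain ⟨U, hx, s, rfl⟩ := F.exists_germ_eq s
  obtain ⟨W, hW, t, rfl⟩ := G.exists_germ_eq t
  -- Shrink `U` until `t` is defined on `ε(U, s)`.
  obtain ⟨V, hV, i, h⟩ := exists_eps_le F s hx W hW
  refine ⟨(box F G).germ V x hV ⟨F.map i.op s, G.map (homOfLE h).op t⟩,
    (boxStalkMap_germ F G V x hV _).trans ?_⟩
  have hs : F.germ V x hV (F.map i.op s) = F.germ U x hx s :=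
    TopCat.Presheaf.germ_res_apply' F i.op x hV s
  refine Sigma.ext hs ?_
  exact (heq_of_eq (TopCat.Presheaf.germ_res_apply' G (homOfLE h).op _ _ t)).trans
    (germ_heq G (congrArg (pt x) hs) _ _ t)

theorem boxStalkMap_injective (x : X.space) : Function.Injective (boxStalkMap F G x) := by
  intro e e' h
  obtain ⟨U, hx, p, rfl⟩ := (box F G).exists_germ_eq e
  obtain ⟨U', hx', p', rfl⟩ := (box F G).exists_germ_eq e'
  replace h : boxGerm F G U x hx p = boxGerm F G U' x hx' p' :=
    (boxStalkMap_germ F G U x hx p).symm.trans (h.trans (boxStalkMap_germ F G U' x hx' p'))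
  -- Restrict first to an open set on which the first components agree.
  obtain ⟨V, hV, i, i', hs⟩ := F.germ_eq x hx hx' p.1 p'.1 (congrArg Sigma.fst h)
  replace h := (boxGerm_res F G i.op x hV p).trans (h.trans (boxGerm_res F G i'.op x hV p').symm)
  refine (box_germ_res F G i x hV p).symm.trans (Eq.trans ?_ (box_germ_res F G i' x hV p'))
  have hs' : (boxRes F G i.op p).1 = (boxRes F G i'.op p').1 := hs
  generalize boxRes F G i.op p = q at *
  generalize boxRes F G i'.op p' = q' at *
  obtain ⟨s, t⟩ := q
  obtain ⟨s', t'⟩ := q'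
  obtain rfl : s = s' := hs'
  -- Then shrink again so that the second components agree on `ε(V', s)`.
  have ht : G.germ (eps F V s) (pt x (F.germ V x hV s)) ⟨hV, rfl⟩ t =
      G.germ (eps F V s) (pt x (F.germ V x hV s)) ⟨hV, rfl⟩ t' :=
    eq_of_heq (Sigma.mk.inj h).2
  obtain ⟨W, hW, j, j', hWt⟩ := G.germ_eq _ _ _ t t' ht
  obtain ⟨V', hV', l, hl⟩ := exists_eps_le F s hV W hW
  refine (box_germ_res F G l x hV' ⟨s, t⟩).symm.trans
    (Eq.trans ?_ (box_germ_res F G l x hV' ⟨s, t'⟩))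
  refine congrArg ((box F G).germ V' x hV') (congrArg (Sigma.mk (F.map l.op s)) ?_)
  refine (map_map_eq G j.op (homOfLE hl).op _ (Subsingleton.elim _ _) t).symm.trans
    ((congrArg _ hWt).trans (map_map_eq G j'.op (homOfLE hl).op _ (Subsingleton.elim _ _) t'))

/-- The bijection `(F ⊠ G)_x ≃ ∐_{s ∈ F_x} G_{(x, s)}`. -/
noncomputable def boxStalkEquiv (x : X.space) :
    (box F G).stalk x ≃ Σ s : F.stalk x, G.stalk (pt x s) :=
  Equiv.ofBijective (boxStalkMap F G x) ⟨boxStalkMap_injective F G x, boxStalkMap_surjective F G x⟩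

theorem boxStalkEquiv_germ (U : Opens X.space) (x : X.space) (hx : x ∈ U) (s : F.obj (op U))
    (t : G.obj (op (eps F U s))) :
    boxStalkEquiv F G x ((box F G).germ U x hx ⟨s, t⟩) = ⟨F.germ U x hx s,
      G.germ (eps F U s) (pt x (F.germ U x hx s)) ⟨hx, rfl⟩ t⟩ :=
  boxStalkMap_germ F G U x hx ⟨s, t⟩

/-- The bijection `Et(G) ≃ Et(F ⊠ G)` assembled from the bijections on stalks. -/
noncomputable def etBoxEquiv : (et G).space ≃ (et (box F G)).space where
  toFun p := pt (base (base p)) ((boxStalkEquiv F G _).symm ⟨germAt (base p), germAt p⟩)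
  invFun q := pt (pt (base q) (boxStalkEquiv F G _ (germAt q)).1) (boxStalkEquiv F G _ (germAt q)).2
  left_inv p := by
    change pt (pt (base (base p)) _) _ = p
    have h := (boxStalkEquiv F G _).apply_symm_apply ⟨germAt (base p), germAt p⟩
    exact (congrArg (fun r : Σ s : F.stalk (base (base p)), G.stalk (pt (base (base p)) s) =>
      (pt (pt (base (base p)) r.1) r.2 : (et G).space)) h)
  right_inv q := congrArg (pt (base q)) ((boxStalkEquiv F G _).symm_apply_apply (germAt q))

theorem etBoxEquiv_pt (x : X.space) (s : F.stalk x) (t : G.stalk (pt x s)) :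
    etBoxEquiv F G (pt (pt x s) t) = pt x ((boxStalkEquiv F G x).symm ⟨s, t⟩) :=
  rfl

theorem etBoxEquiv_germ (U : Opens X.space) (x : X.space) (hx : x ∈ U) (s : F.obj (op U))
    (t : G.obj (op (eps F U s))) :
    etBoxEquiv F G (pt (pt x (F.germ U x hx s))
      (G.germ (eps F U s) (pt x (F.germ U x hx s)) ⟨hx, rfl⟩ t)) =
        pt x ((box F G).germ U x hx ⟨s, t⟩) := by
  rw [etBoxEquiv_pt, ← boxStalkEquiv_germ, Equiv.symm_apply_apply]

theorem etBoxEquiv_image (U : Opens X.space) (s : F.obj (op U)) (t : G.obj (op (eps F U s))) :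
    etBoxEquiv F G '' (eps G (eps F U s) t) = eps (box F G) U ⟨s, t⟩ := by
  ext q
  constructor
  · rintro ⟨_, hp, rfl⟩
    obtain ⟨_, h, rfl⟩ := (mem_epsSet _ _ _ _).1 hp
    obtain ⟨x, hx, rfl⟩ := (mem_epsSet _ _ _ _).1 h
    exact (mem_epsSet _ _ _ _).2 ⟨x, hx, (etBoxEquiv_germ F G U x hx s t).symm⟩
  · intro hq
    obtain ⟨x, hx, rfl⟩ := (mem_epsSet _ _ _ _).1 hq
    exact ⟨_, (mem_epsSet _ _ _ _).2 ⟨pt x (F.germ U x hx s), ⟨hx, rfl⟩, rfl⟩,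
      etBoxEquiv_germ F G U x hx s t⟩

/-- The sets `ε(ε(U, s), t)` form a basis of the topology of `Et(G)`. -/
theorem exists_eps_eps_le (W : Opens (et G).space) {p : (et G).space} (hp : p ∈ W) :
    ∃ (U : Opens X.space) (s : F.obj (op U)) (t : G.obj (op (eps F U s))),
      p ∈ eps G (eps F U s) t ∧ eps G (eps F U s) t ≤ W := by
  obtain ⟨⟨x, e⟩, g⟩ := p
  obtain ⟨U, hx, s, rfl⟩ := F.exists_germ_eq e
  obtain ⟨S, hS, t, rfl⟩ := G.exists_germ_eq g
  obtain ⟨T, hT, i, h⟩ := exists_eps_le G t hS W hp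
  obtain ⟨V, hV, j, h'⟩ := exists_eps_le F s hx T hT
  refine ⟨V, F.map j.op s, G.map (homOfLE h').op (G.map i.op t),
    ⟨⟨hV, (TopCat.Presheaf.germ_res_apply' F j.op x hV s).symm⟩, ?_⟩,
    (eps_res G (homOfLE h').op _).trans h⟩
  refine (TopCat.Presheaf.germ_res_apply' G i.op _ hT t).symm.trans ?_
  exact (TopCat.Presheaf.germ_res_apply' G (homOfLE h').op _ _ _).symm

/-- The homeomorphism `Et(G) ≃ Et(F ⊠ G)`. It identifies the bases of open sets `ε(ε(U, s), t)`
and `ε(U, (s, t))`. -/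
noncomputable def etBoxHomeomorph : (et G).space ≃ₜ (et (box F G)).space where
  toEquiv := etBoxEquiv F G
  continuous_toFun := by
    refine continuous_generateFrom_iff.2 ?_
    rintro _ ⟨U, p, rfl⟩
    convert (eps G (eps F U p.1) p.2).isOpen using 1
    exact (congrArg _ (etBoxEquiv_image F G U p.1 p.2).symm).trans
      ((etBoxEquiv F G).injective.preimage_image _)
  continuous_invFun := by
    refine continuous_def.2 fun W hW => ?_
    rw [Equiv.invFun_as_coe, ← Equiv.image_eq_preimage_symm]
    refine isOpen_iff_forall_mem_open.2 ?_
    rintro _ ⟨p, hp, rfl⟩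
    obtain ⟨U, s, t, hpU, hle⟩ := exists_eps_eps_le F G ⟨W, hW⟩ hp
    refine ⟨_, Set.image_mono hle, ?_, Set.mem_image_of_mem _ hpU⟩
    rw [etBoxEquiv_image]
    exact (eps (box F G) U ⟨s, t⟩).isOpen

theorem etBoxEquiv_naturality {X' : TopOpen.{u}} (k : X ⟶ X') {F : Psh X} {G : Psh (et F)}
    {F' : Psh X'} {G' : Psh (et F')} (τ : F ⟶ pull k F') (ρ : G ⟶ pull (etMap k τ) G')
    (p : (et G).space) :
    etBoxEquiv F' G' ((etMap (etMap k τ) ρ).toFun p) =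
      (etMap k (boxMap k τ ρ)).toFun (etBoxEquiv F G p) := by
  obtain ⟨U, s, t, hp, -⟩ := exists_eps_eps_le F G ⊤ (Opens.mem_top p)
  obtain ⟨_, h, rfl⟩ := (mem_epsSet _ _ _ _).1 hp
  obtain ⟨x, hx, rfl⟩ := (mem_epsSet _ _ _ _).1 h
  have h₁ := etMap_germ (etMap k τ) ρ (eps F U s) (pt x (F.germ U x hx s)) ⟨hx, rfl⟩ t
  have h₂ := etMap_germ k (boxMap k τ ρ) U x hx ⟨s, t⟩
  refine (congrArg (etBoxEquiv F' G') h₁).trans (Eq.trans ?_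
    ((congrArg (etMap k (boxMap k τ ρ)).toFun (etBoxEquiv_germ F G U x hx s t)).trans h₂).symm)
  refine Eq.trans (congrArg (etBoxEquiv F' G') ?_)
    (etBoxEquiv_germ F' G' (image k U) (k.toFun x) ⟨x, hx, rfl⟩ (τ.app (op U) s)
      (boxMapFun k τ ρ U ⟨s, t⟩).2)
  have h₃ := pt_germ_eqToHom G' (etMap_image k τ U s) (etMap_germ k τ U x hx s)
    ⟨_, ⟨hx, rfl⟩, rfl⟩ ⟨⟨x, hx, rfl⟩, rfl⟩ (ρ.app (op (eps F U s)) t)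
  exact h₃

end TopOpen

/-! ### The left module of topological spaces and open maps -/

namespace TopOpen

theorem etMap_etPsh {X Y : TopOpen.{u}} (k : X ⟶ Y) {F : Psh X} {G H : Psh Y}
    (τ : F ⟶ pull k G) (ρ : G ⟶ H) : etMap k τ ≫ etPsh ρ = etMap k (τ ≫ pullMap k ρ) := by
  simp only [etMap, etPsh_comp, Category.assoc, etPull_naturality]

theorem etPsh_etMap {X Y : TopOpen.{u}} (k : X ⟶ Y) {F G : Psh X} {H : Psh Y}
    (ρ : F ⟶ G) (τ : G ⟶ pull k H) : etPsh ρ ≫ etMap k τ = etMap k (ρ ≫ τ) := by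
  simp only [etMap, etPsh_comp, Category.assoc]

theorem image_comp {X Y Z : TopOpen.{u}} (k : X ⟶ Y) (l : Y ⟶ Z) (U : Opens X.space) :
    image (k ≫ l) U = image l (image k U) :=
  Opens.ext (Set.image_comp l.toFun k.toFun _)

/-- The projection of the étalé space of a presheaf whose values are one-point sets is an
isomorphism. -/
theorem isIso_etProj {X : TopOpen.{u}} (F : Psh X) [∀ U, Unique (F.obj U)] : IsIso (etProj F) := by
  -- The inverse sends `x` to the germ at `x` of the unique global section.
  let l : X.space → F.EtaleSpace := fun x => ⟨x, F.germ ⊤ x trivial default⟩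
  have hl : ∀ (U : Opens X.space) (x : X.space) (hx : x ∈ U) (s : F.obj (op U)),
      l x = TopCat.Presheaf.EtaleSpace.mk x (F.germ U x hx s) := fun U x hx s =>
    congrArg (TopCat.Presheaf.EtaleSpace.mk x) <|
      (TopCat.Presheaf.germ_res_apply F (homOfLE le_top) x hx default).symm.trans
        (congrArg (F.germ U x hx) (Subsingleton.elim _ _))
  have ho : IsOpenMap l := fun U hU => by
    refine (congrArg IsOpen (Set.ext fun e => ?_)).mpr (eps F ⟨U, hU⟩ default).isOpen
    refine Iff.trans ?_ (mem_epsSet F ⟨U, hU⟩ default e).symm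
    exact ⟨fun ⟨x, hx, h⟩ => ⟨x, hx, (hl _ x hx _).symm.trans h⟩,
      fun ⟨x, hx, h⟩ => ⟨x, hx, (hl _ x hx _).trans h⟩⟩
  exact ⟨⟨l, ho⟩, et_hom_ext fun U x hx s => hl U x hx s, rfl⟩

/-- The homeomorphism `Et(G) ≃ Et(F ⊠ G)` as an isomorphism in the category of open maps. -/
noncomputable def etBoxIso {X : TopOpen.{u}} (F : Psh X) (G : Psh (et F)) :
    et G ≅ et (box F G) where
  hom := ⟨etBoxHomeomorph F G, (etBoxHomeomorph F G).isOpenMap⟩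
  inv := ⟨(etBoxHomeomorph F G).symm, (etBoxHomeomorph F G).symm.isOpenMap⟩
  hom_inv_id := hom_ext (etBoxHomeomorph F G).symm_apply_apply
  inv_hom_id := hom_ext (etBoxHomeomorph F G).apply_symm_apply

theorem etBoxIso_image {X : TopOpen.{u}} (F : Psh X) (G : Psh (et F)) (U : Opens X.space)
    (s : F.obj (op U)) (t : G.obj (op (eps F U s))) :
    image (etBoxIso F G).hom (eps G (eps F U s) t) = eps (box F G) U ⟨s, t⟩ :=
  Opens.ext (etBoxEquiv_image F G U s t)

section

variable {D : Type*} [Category* D] {E : Type*} [Category* E]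

/-- The morphism of presheaves `f ∘ ι_d ⟶ α_d^* (f' ∘ ι_{g(d)})` with components those of `θ`. -/
def fibreCongr (g : D ⥤ E) {m : D ⥤ TopOpen.{u}} {n : E ⥤ TopOpen.{u}} (α : m ⟶ g ⋙ n)
    {f : Tot ouv m ⥤ Type u} {f' : Tot ouv n ⥤ Type u} (θ : f ⟶ Tot.change ouv g α ⋙ f') (d : D) :
    fibre m f d ⟶ pull (α.app d) (fibre n f' (g.obj d)) where
  app U := θ.app ⟨d, U⟩
  naturality U V i := by
    refine (θ.naturality ((Grothendieck.ι (m ⋙ ouv) d).map i)).trans ?_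
    refine congrArg (fun k => θ.app ⟨d, U⟩ ≫ f'.map k) (Tot.hom_ext (thin n) ?_)
    exact g.map_id d

instance (g : D ⥤ E) {m : D ⥤ TopOpen.{u}} {n : E ⥤ TopOpen.{u}} (α : m ⟶ g ⋙ n)
    {f : Tot ouv m ⥤ Type u} {f' : Tot ouv n ⥤ Type u} (θ : f ⟶ Tot.change ouv g α ⋙ f')
    [IsIso θ] (d : D) : IsIso (fibreCongr g α θ d) :=
  have (U : (Opens (m.obj d).space)ᵒᵖ) : IsIso ((fibreCongr g α θ d).app U) :=
    inferInstanceAs (IsIso (θ.app ⟨d, U⟩))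
  NatIso.isIso_of_isIso_app _

/-- `∑_m f ≅ (∑_n f') ∘ g`, `(x, s_x) ↦ (α(x), θ(s)_{α(x)})`. -/
noncomputable def sumCongr (g : D ⥤ E) {m : D ⥤ TopOpen.{u}} {n : E ⥤ TopOpen.{u}} (α : m ≅ g ⋙ n)
    {f : Tot ouv m ⥤ Type u} {f' : Tot ouv n ⥤ Type u} (θ : f ≅ Tot.change ouv g α.hom ⋙ f') :
    sum m f ≅ g ⋙ sum n f' :=
  NatIso.ofComponents (fun d => show et (fibre m f d) ≅ et (fibre n f' (g.obj d)) from
      have : IsIso (etMap (α.hom.app d) (fibreCongr g α.hom θ.hom d)) :=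
        isIso_etMap (α.hom.app d) (fibreCongr g α.hom θ.hom d)
      @asIso _ _ _ _ (etMap (α.hom.app d) (fibreCongr g α.hom θ.hom d)) this)
    (fun {d e} k => et_hom_ext fun U x hx s => by
      have hU : image (α.hom.app e) (image (m.map k) U) =
          image (n.map (g.map k)) (image (α.hom.app d) U) := by
        rw [← image_comp, ← image_comp]
        exact congrArg (fun l => image l U) (α.hom.naturality k)
      have hx' : (α.hom.app e).toFun ((m.map k).toFun x) =
          (n.map (g.map k)).toFun ((α.hom.app d).toFun x) :=
        congrArg (fun l => Hom.toFun l x) (α.hom.naturality k)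
      refine ((congrArg (etMap (α.hom.app e) (fibreCongr g α.hom θ.hom e)).toFun
        (etMap_germ _ (fibreMap m f k) U x hx s)).trans (etMap_germ _ _ _ _ _ _)).trans
        (Eq.trans ?_ ((congrArg (etMap (n.map (g.map k)) (fibreMap n f' (g.map k))).toFun
          (etMap_germ _ (fibreCongr g α.hom θ.hom d) U x hx s)).trans
            (etMap_germ _ _ _ _ _ _)).symm)
      refine mk_germ_eq n f' hU (mkHom n (𝟙 (g.obj e)) _ _ (by rw [image_map_id, hU])) rfl
        hx' _ _ _ _ ?_
      have hθ := ConcreteCategory.congr_hom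
        (θ.hom.naturality ((Grothendieck.ιNatTrans k).app (op U))) s
      exact (congrArg _ hθ).trans
        (map_map_eq f' _ _ _ (Tot.hom_ext (thin n) (Category.comp_id _)) _))

theorem sumCongr_image (g : D ⥤ E) {m : D ⥤ TopOpen.{u}} {n : E ⥤ TopOpen.{u}} (α : m ≅ g ⋙ n)
    {f : Tot ouv m ⥤ Type u} {f' : Tot ouv n ⥤ Type u} (θ : f ≅ Tot.change ouv g α.hom ⋙ f')
    (d : D) (U : Opens (m.obj d).space) (s : (fibre m f d).obj (op U)) :
    image ((sumCongr g α θ).hom.app d) (eps (fibre m f d) U s) =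
      eps (fibre n f' (g.obj d)) (image (α.hom.app d) U) (θ.hom.app ⟨d, op U⟩ s) :=
  etMap_image (α.hom.app d) (fibreCongr g α.hom θ.hom d) U s

/-- `∑_m 1 ≅ m`. -/
noncomputable def sumOne (m : D ⥤ TopOpen.{u}) :
    sum m ((Functor.const (Tot ouv m)).obj PUnit.{u + 1}) ≅ m :=
  NatIso.ofComponents
    (fun d =>
      have (U : (Opens (m.obj d).space)ᵒᵖ) :
          Unique ((fibre m ((Functor.const (Tot ouv m)).obj PUnit.{u + 1}) d).obj U) :=
        inferInstanceAs (Unique PUnit.{u + 1})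
      have := isIso_etProj (fibre m ((Functor.const (Tot ouv m)).obj PUnit.{u + 1}) d)
      @asIso _ _ _ _ (etProj (fibre m ((Functor.const (Tot ouv m)).obj PUnit.{u + 1}) d)) this)
    (fun _ => rfl)

variable (m : D ⥤ TopOpen.{u}) (f : Tot ouv m ⥤ Type u) (g : Tot ouv (sum m f) ⥤ Type u)

/-- The action of `f ⊠ g` on morphisms over an identity is the restriction of `F_d ⊠ G_d`. -/
theorem sumMap_eq_boxRes {d : D} {V W : (Opens (m.obj d).space)ᵒᵖ} (i : V ⟶ W)
    (p : BoxObj (fibre m f d) (fibre (sum m f) g d) V.unop) :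
    SetAdder.sumMap f (flat m f ⋙ g) ((Grothendieck.ι (m ⋙ ouv) d).map i) p =
      boxRes (fibre m f d) (fibre (sum m f) g d) i p :=
  box_ext (F := fibre m f d) (G := fibre (sum m f) g d) (V := W.unop) rfl (𝟙 _)
    (map_map_eq g _ _ _ (Tot.hom_ext (thin _) (Category.comp_id _)) p.2)

/-- The action of `f ⊠ g` on the morphisms `(d, V) ⟶ (e, m(k)(V))` is the map that `m(k)` induces
from `F_d ⊠ G_d` to `F_e ⊠ G_e`. -/
theorem sumMap_eq_boxMapFun {d e : D} (k : d ⟶ e) (V : Opens (m.obj d).space)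
    (p : BoxObj (fibre m f d) (fibre (sum m f) g d) V) :
    SetAdder.sumMap f (flat m f ⋙ g) ((Grothendieck.ιNatTrans (F := m ⋙ ouv) k).app (op V)) p =
      boxMapFun (m.map k) (fibreMap m f k) (fibreMap (sum m f) g k) V p :=
  box_ext (F := fibre m f e) (G := fibre (sum m f) g e) (V := image (m.map k) V) rfl (𝟙 _)
    ((map_map_eq g _ _ _ (Tot.hom_ext (thin _) rfl) p.2).trans
      (map_map_eq g ((Grothendieck.ιNatTrans (F := sum m f ⋙ ouv) k).app _)
        ((Grothendieck.ι (sum m f ⋙ ouv) e).map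
          (homOfLE (etMap_image (m.map k) (fibreMap m f k) V p.1).ge).op) _ rfl p.2).symm)

/-- `(f ⊠ g)(d, -) ≅ F_d ⊠ G_d`, the identity on pairs `(s, t)`. -/
noncomputable def fibreBoxIso (d : D) :
    fibre m (SetAdder.sum f (flat m f ⋙ g)) d ≅ box (fibre m f d) (fibre (sum m f) g d) :=
  NatIso.ofComponents (fun V => Iso.refl (BoxObj (fibre m f d) (fibre (sum m f) g d) V.unop))
    (fun i => ConcreteCategory.hom_ext _ _ fun p =>
      sumMap_eq_boxRes m f g i p)

theorem fibreBoxIso_naturality {d e : D} (k : d ⟶ e) :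
    boxMap (m.map k) (fibreMap m f k) (fibreMap (sum m f) g k) ≫
        pullMap (m.map k) (fibreBoxIso m f g e).inv =
      (fibreBoxIso m f g d).inv ≫ fibreMap m (SetAdder.sum f (flat m f ⋙ g)) k := by
  ext V p
  exact (sumMap_eq_boxMapFun m f g k V p).symm

/-- `∑_{∑_m f} g ≅ ∑_m (f ⊠ g)`. -/
noncomputable def sumAssoc : sum (sum m f) g ≅ sum m (SetAdder.sum f (flat m f ⋙ g)) :=
  NatIso.ofComponents
    (fun d => etBoxIso (fibre m f d) (fibre (sum m f) g d) ≪≫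
      (etFunctor (m.obj d)).mapIso (fibreBoxIso m f g d).symm)
    (fun {d e} k => by
      change etMap (etMap (m.map k) (fibreMap m f k)) (fibreMap (sum m f) g k) ≫
          (etBoxIso _ _).hom ≫ etPsh (fibreBoxIso m f g e).inv =
        ((etBoxIso _ _).hom ≫ etPsh (fibreBoxIso m f g d).inv) ≫ etMap (m.map k) (fibreMap m _ k)
      have h : etMap (etMap (m.map k) (fibreMap m f k)) (fibreMap (sum m f) g k) ≫
            (etBoxIso _ _).hom =
          (etBoxIso _ _).hom ≫ etMap (m.map k)
            (boxMap (m.map k) (fibreMap m f k) (fibreMap (sum m f) g k)) :=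
        hom_ext (etBoxEquiv_naturality _ _ _)
      rw [reassoc_of% h, Category.assoc, etMap_etPsh, etPsh_etMap, fibreBoxIso_naturality])

theorem sumAssoc_image (d : D) (U : Opens (m.obj d).space) (s : (fibre m f d).obj (op U))
    (t : (fibre (sum m f) g d).obj (op (eps (fibre m f d) U s))) :
    image ((sumAssoc m f g).hom.app d) (eps (fibre (sum m f) g d) (eps (fibre m f d) U s) t) =
      eps (fibre m (SetAdder.sum f (flat m f ⋙ g)) d) U ⟨s, t⟩ :=
  (image_comp _ _ _).trans ((congrArg _ (etBoxIso_image _ _ U s t)).trans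
    (etPsh_image (fibreBoxIso m f g d).inv U ⟨s, t⟩))

end

end TopOpen

theorem topOpenModule_isLeftModule : topOpenModule.{v, w, u}.IsLeftModule where
  flat_over _ _ := rfl
  natural g _ n α _ f' θ := ⟨TopOpen.sumCongr g α θ,
    Tot.isoOver_of_thin (TopOpen.thin _)
      (fun p => congrArg (fun W => (⟨g.obj p.base.base, op W⟩ : Tot TopOpen.ouv (TopOpen.sum n f')))
        (TopOpen.sumCongr_image g α θ _ _ p.fiber.as)) rfl⟩
  unit m := ⟨TopOpen.sumOne m⟩
  assoc m f g := ⟨TopOpen.sumAssoc m f g,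
    Tot.isoOver_of_thin (TopOpen.thin _)
      (fun p => congrArg (fun W => (⟨p.base.base.base, op W⟩ : Tot TopOpen.ouv
          (TopOpen.sum m (SetAdder.sum f (TopOpen.flat m f ⋙ g)))))
        (TopOpen.sumAssoc_image m f g _ _ p.base.fiber.as p.fiber.as).symm) rfl⟩

theorem mainTheorem7 :
    setAdder.{v, w, u}.IsDependentAdder ∧
    topOpenModule.{v, w, u}.IsLeftModule ∧
    (∀ (D : Type (max w (u + 1))) [Category.{max v u} D] (m : D ⥤ TopOpen.{u})
        (f : Tot TopOpen.ouv m ⥤ Type u),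
      (∀ d : D, (topOpenModule.{v, w, u}.sum m f).obj d = TopOpen.et (TopOpen.fibre m f d)) ∧
      (∀ (d : D) (U : Opens (m.obj d).space) (s : f.obj ⟨d, op U⟩),
        (topOpenModule.{v, w, u}.flat m f).obj ⟨⟨d, op U⟩, ⟨s⟩⟩ =
          ⟨d, op (TopOpen.eps (TopOpen.fibre m f d) U s)⟩) ∧
      ((∀ (d e : D) (k : d ⟶ e), Continuous (m.map k).toFun) →
        ∀ (d e : D) (k : d ⟶ e),
          Continuous ((topOpenModule.{v, w, u}.sum m f).map k).toFun) ∧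
      (∀ (g : Tot TopOpen.ouv (TopOpen.sum m f) ⥤ Type u) (d : D),
        ∃ e : TopOpen.fibre m (topOpenModule.{v, w, u}.boxTimes m f g) d ≅
            TopOpen.box (TopOpen.fibre m f d) (TopOpen.fibre (TopOpen.sum m f) g d),
          ∀ (V : Opens (m.obj d).space) (s : f.obj ⟨d, op V⟩)
            (t : g.obj ⟨d, op (TopOpen.eps (TopOpen.fibre m f d) V s)⟩),
            e.hom.app (op V) ⟨s, t⟩ = ⟨s, t⟩)) ∧
    (∀ (X : TopOpen.{u}) (F G H : TopOpen.Psh X) (τ : F ⟶ G) (ρ : G ⟶ H),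
      TopOpen.etPsh (𝟙 F) = 𝟙 (TopOpen.et F) ∧
      TopOpen.etPsh (τ ≫ ρ) = TopOpen.etPsh τ ≫ TopOpen.etPsh ρ ∧
      ∀ (U : Opens X.space) (s : F.obj (op U)),
        TopOpen.image (TopOpen.etPsh τ) (TopOpen.eps F U s) = TopOpen.eps G U (τ.app (op U) s)) ∧
    (∀ (X Y : TopOpen.{u}) (k : X ⟶ Y) (F : TopOpen.Psh Y),
      (∀ (U : Opens X.space) (x : X.space) (hx : x ∈ U) (s : F.obj (op (TopOpen.image k U))),
        (TopOpen.etPull k F).toFun (TopOpen.pt x ((TopOpen.pull k F).germ U x hx s)) =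
          TopOpen.pt (k.toFun x) (F.germ (TopOpen.image k U) (k.toFun x) ⟨x, hx, rfl⟩ s)) ∧
      (∀ (U : Opens X.space) (s : F.obj (op (TopOpen.image k U))),
        TopOpen.image (TopOpen.etPull k F) (TopOpen.eps (TopOpen.pull k F) U s) =
          TopOpen.eps F (TopOpen.image k U) s) ∧
      (∀ (G : TopOpen.Psh Y) (τ : F ⟶ G),
        TopOpen.etPull k F ≫ TopOpen.etPsh τ =
          TopOpen.etPsh (TopOpen.pullMap k τ) ≫ TopOpen.etPull k G) ∧
      TopOpen.etPull (𝟙 Y) F = TopOpen.etPsh (eqToHom (TopOpen.pull_id F)) ∧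
      (∀ (W : TopOpen.{u}) (l : W ⟶ X),
        TopOpen.etPull l (TopOpen.pull k F) ≫ TopOpen.etPull k F =
          TopOpen.etPsh (eqToHom (TopOpen.pull_comp l k F)) ≫ TopOpen.etPull (l ≫ k) F)) ∧
    (∃ (σ : ∀ {X : TopOpen.{u}} (F : TopOpen.Psh X) (G : TopOpen.Psh (TopOpen.et F)) (x : X.space),
          (TopOpen.box F G).stalk x ≃ Σ s : F.stalk x, G.stalk (TopOpen.pt x s))
        (Φ : ∀ {X : TopOpen.{u}} (F : TopOpen.Psh X) (G : TopOpen.Psh (TopOpen.et F)),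
          (TopOpen.et G).space ≃ₜ (TopOpen.et (TopOpen.box F G)).space),
      (∀ {X : TopOpen.{u}} (F : TopOpen.Psh X) (G : TopOpen.Psh (TopOpen.et F)),
        (∀ (U : Opens X.space) (x : X.space) (hx : x ∈ U) (s : F.obj (op U))
            (t : G.obj (op (TopOpen.eps F U s))),
          σ F G x ((TopOpen.box F G).germ U x hx ⟨s, t⟩) =
            ⟨F.germ U x hx s, G.germ (TopOpen.eps F U s) (TopOpen.pt x (F.germ U x hx s))
              ⟨hx, rfl⟩ t⟩) ∧
        (∀ (x : X.space) (s : F.stalk x) (t : G.stalk (TopOpen.pt x s)),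
          Φ F G (TopOpen.pt (TopOpen.pt x s) t) = TopOpen.pt x ((σ F G x).symm ⟨s, t⟩)) ∧
        (∀ (U : Opens X.space) (s : F.obj (op U)) (t : G.obj (op (TopOpen.eps F U s))),
          (TopOpen.eps (TopOpen.box F G) U ⟨s, t⟩ : Set (TopOpen.et (TopOpen.box F G)).space) =
            Φ F G '' (TopOpen.eps G (TopOpen.eps F U s) t))) ∧
      (∀ {X X' : TopOpen.{u}} (k : X ⟶ X') {F : TopOpen.Psh X} {G : TopOpen.Psh (TopOpen.et F)}
          {F' : TopOpen.Psh X'} {G' : TopOpen.Psh (TopOpen.et F')} (τ : F ⟶ TopOpen.pull k F')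
          (ρ : G ⟶ TopOpen.pull (TopOpen.etMap k τ) G') (p : (TopOpen.et G).space),
        Φ F' G' ((TopOpen.etMap (TopOpen.etMap k τ) ρ).toFun p) =
          (TopOpen.etMap k (TopOpen.boxMap k τ ρ)).toFun (Φ F G p))) := by
  refine ⟨setAdder_isDependentAdder, topOpenModule_isLeftModule, fun D _ m f => ⟨fun _ => rfl,
      fun _ _ _ => rfl,
      fun hm d e k => TopOpen.continuous_etMap (m.map k) (hm d e k) (TopOpen.fibreMap m f k),
      fun g d => ⟨TopOpen.fibreBoxIso m f g d, fun _ _ _ => rfl⟩⟩,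
    fun X F G H τ ρ => ⟨TopOpen.etPsh_id F, TopOpen.etPsh_comp τ ρ, TopOpen.etPsh_image τ⟩,
    fun X Y k F => ⟨TopOpen.etPullFun_germ k F, TopOpen.etPull_image k F,
      fun G τ => TopOpen.etPull_naturality k τ, TopOpen.etPull_id F,
      fun W l => TopOpen.etPull_comp l k F⟩,
    TopOpen.boxStalkEquiv, TopOpen.etBoxHomeomorph, fun F G => ⟨TopOpen.boxStalkEquiv_germ F G,
      TopOpen.etBoxEquiv_pt F G, fun U s t => (TopOpen.etBoxEquiv_image F G U s t).symm⟩,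
    TopOpen.etBoxEquiv_naturality⟩
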